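/- For $k\ge 2$ let $\mathbb G_A^{(k)}$ be the $k$-vertex antiregular graph (the connected simple graph with exactly one pair of vertices of equal degree), numbered so that distinct vertices $i,j\in\{1,\dots,k\}$ are adjacent if and only if $i+j\le k+1$. Then vertex $1$ is dominating (degree $k-1$), vertex $k$ is terminal (degree $1$), and the two degree-repeating vertices are $\lceil k/2\rceil$ and $\lceil k/2\rceil+1$. For a graph $G$ with Laplacian matrix $\mathcal L$ and a vector $\mathbf b$, the pair $(G,\mathbf b)$ is called Laplacian controllable if the single-input system $\dot{\mathbf x}=-\mathcal L\mathbf x+\mathbf b\,u(t)$ is controllable, i.e. every initial state can be steered to every final state in finite time. Let $k_1\ge 1$, $k_2\ge 3$ and $\bar\kappa_2=\lceil k_2/2\rceil$. Take $k_1$ copies of $\mathbb G_A^{(k_2)}$ and, for each $i=1,\dots,k_1-1$, add one edge joining a chosen vertex of copy $i$, which is either its vertex $1$ (dominating) or its vertex $k_2$ (terminal), the choice being arbitrary and independent for each $i$, to the degree-repeating vertex $\bar\kappa_2$ of copy $i+1$. Call the resulting graph $\mathbb G_A^{(1,2)}$. Let $\mathbf b\in\{0,1\}^{k_2}$ and let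 $\bar{\mathbf b}\in\{0,1\}^{k_1k_2}$ be the vector equal to $\mathbf b$ on the first copy and $0$ on all other copies. (a) If the first link ($i=1$) uses the dominating vertex $1$ of the first copy, then the following are equivalent: 1. the $\bar\kappa_2$-th and $(\bar\kappa_2+1)$-th entries of $\mathbf b$ sum to $1$; 2. $(\mathbb G_A^{(k_2)},\mathbf b)$ is Laplacian controllable; 3. $(\mathbb G_A^{(1,2)},\bar{\mathbf b})$ is Laplacian controllable. (b) If the first link uses the terminal vertex $k_2$ of the first copy, $k_2\ge 4$, and the $k_2$-th entry of $\mathbf b$ is $0$, then the same three statements are equivalent. (When $k_1=1$ there are no links and both (a) and (b) apply.) -/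

import Mathlib

/-- The linear time-invariant single-input system `x' = A x + b u(t)` is controllable: every initial
state can be transferred to every final state in finite time by some (continuous) input. -/
def SystemControllable {V : Type*} [Fintype V] (A : Matrix V V ℝ) (b : V → ℝ) : Prop :=
  ∀ xi xf : V → ℝ, ∃ T : ℝ, 0 < T ∧ ∃ (u : ℝ → ℝ) (x : ℝ → V → ℝ),
    ContinuousOn u (Set.Icc 0 T) ∧ x 0 = xi ∧ x T = xf ∧
      ∀ t ∈ Set.Icc 0 T,
        HasDerivWithinAt x (A.mulVec (x t) + u t • b) (Set.Icc 0 T) t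

/-- The pair `(L, b)`, with `L` the Laplacian matrix of `G`, is Laplacian controllable:
the system `x' = -L x + b u(t)` is controllable. -/
def LaplacianControllable {V : Type*} [Fintype V] [DecidableEq V] (G : SimpleGraph V)
    [DecidableRel G.Adj] (b : V → ℝ) : Prop :=
  SystemControllable (-(G.lapMatrix ℝ)) b

/-- The `k`-vertex antiregular graph in its standard numbering. With vertices numbered `1, …, k`
(vertex `i : Fin k` has number `i + 1`), distinct vertices are adjacent iff their numbers add up to
at most `k + 1`. Vertex `1` is dominating, vertex `k` is terminal, and vertices
`⌈k/2⌉` and `⌈k/2⌉ + 1` are the degree-repeating ones. -/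
def antiregularGraph (k : ℕ) : SimpleGraph (Fin k) where
  Adj i j := i ≠ j ∧ ((i : ℕ) + 1) + ((j : ℕ) + 1) ≤ k + 1
  symm := ⟨fun _ _ h => ⟨h.1.symm, by have := h.2; omega⟩⟩
  loopless := ⟨fun _ h => h.1 rfl⟩

instance antiregularGraph.instDecidableRelAdj (k : ℕ) : DecidableRel (antiregularGraph k).Adj :=
  fun i j => inferInstanceAs (Decidable (i ≠ j ∧ ((i : ℕ) + 1) + ((j : ℕ) + 1) ≤ k + 1))

/-- The vertex of a copy of the antiregular graph to which the next copy gets linked. -/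
inductive LinkEnd where
  | dominating
  | terminal

/-- The position, counted from `0`, of the chosen vertex among the `k` vertices of a copy. -/
def LinkEnd.pos (k : ℕ) : LinkEnd → ℕ
  | .dominating => 0
  | .terminal => k - 1

/-- The edge from copy `i` to copy `i + 1` (copies counted from `0`): it joins the vertex `s i` of
copy `i` to the degree-repeating vertex number `⌈k₂/2⌉` of copy `i + 1`. -/
def IsLink (k₁ k₂ : ℕ) (s : ℕ → LinkEnd) (v w : Fin k₁ × Fin k₂) : Prop :=
  (w.1 : ℕ) = (v.1 : ℕ) + 1 ∧ (v.2 : ℕ) = (s v.1).pos k₂ ∧ (w.2 : ℕ) = (k₂ + 1) / 2 - 1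

instance IsLink.instDecidable (k₁ k₂ : ℕ) (s : ℕ → LinkEnd) (v w : Fin k₁ × Fin k₂) :
    Decidable (IsLink k₁ k₂ s v w) :=
  inferInstanceAs (Decidable ((w.1 : ℕ) = (v.1 : ℕ) + 1 ∧
    (v.2 : ℕ) = (s v.1).pos k₂ ∧ (w.2 : ℕ) = (k₂ + 1) / 2 - 1))

/-- The interconnection of `k₁` copies of the `k₂`-vertex antiregular graph; the vertex `(i, j)` is
vertex `j` of copy `i`. Only the values `s 0, …, s (k₁ - 2)`, one for each link, matter. -/
def interconnectedGraph (k₁ k₂ : ℕ) (s : ℕ → LinkEnd) : SimpleGraph (Fin k₁ × Fin k₂) where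
  Adj v w := (v.1 = w.1 ∧ (antiregularGraph k₂).Adj v.2 w.2) ∨
    IsLink k₁ k₂ s v w ∨ IsLink k₁ k₂ s w v
  symm := ⟨fun _ _ h => h.elim (fun h => Or.inl ⟨h.1.symm, h.2.symm⟩) (fun h => Or.inr h.symm)⟩
  loopless := ⟨fun v h => by
    rcases h with h | h | h
    · exact (antiregularGraph k₂).loopless.irrefl _ h.2
    · have := h.1; omega
    · have := h.1; omega⟩

instance interconnectedGraph.instDecidableRelAdj (k₁ k₂ : ℕ) (s : ℕ → LinkEnd) :
    DecidableRel (interconnectedGraph k₁ k₂ s).Adj :=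
  fun v w => inferInstanceAs (Decidable ((v.1 = w.1 ∧ (antiregularGraph k₂).Adj v.2 w.2) ∨
    IsLink k₁ k₂ s v w ∨ IsLink k₁ k₂ s w v))

/-- The zero-padding of `b`: equal to `b` on the first copy and to `0` on all the others. -/
def zeroPad (k₁ : ℕ) {k₂ : ℕ} (b : Fin k₂ → ℝ) : Fin k₁ × Fin k₂ → ℝ :=
  fun v => if (v.1 : ℕ) = 0 then b v.2 else 0

/-! By the Hautus test for symmetric matrices (`not_systemControllable_of_eigenvector`,
`systemControllable_of_eigenvector`), controllability means that no Laplacian eigenvector is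
orthogonal to the input vector. Both equivalences therefore concern eigenvectors.

For a single antiregular graph the null vectors of `L - μ` are known explicitly
(`antiregularOp_eq_zero_cases`): constants, or multiples of vectors of zero sum that have one
exceptional entry and are 0 or 1 elsewhere. All the nonconstant ones are nonzero at both
degree-repeating vertices (the twins), and one is supported exactly there with opposite entries.
That one is orthogonal to `b` when `b` agrees on the twins. Extended by zero it stays an eigenvector
of the chain, because the first copy's link avoids the twins; this gives necessity. If `b` separates
the twins, a sign argument shows that no eigenvector is orthogonal to it.

For sufficiency in the chain (`chain_eq_zero`), treat the links as wires: copy `a` satisfies `(L -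
μ) X a = F a • e_twin - F (a + 1) • e_end`, where `F a` is the flow entering it and both outer flows
vanish. If `μ` is an eigenvalue of one copy, pairing with an eigenvector kills all flows, from the
last copy backwards; the copies then decouple and vanish one after another. Otherwise the first copy
is a multiple of an explicit response `endResponse`, and orthogonality to `b` forces the first flow
to vanish unless `μ = ⌈k / 2⌉` (`eq_zero_or_eq_of_sum_eq_zero`). At that value the rest of the chain
presents an impedance to the first copy. `exists_impedance_set` confines all such impedances to a
set that excludes resonance with the first copy, so the first flow vanishes again. -/

/-! ### The Hautus test for symmetric systems. -/

section Controllability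

open Matrix Polynomial

variable {V : Type*} [Fintype V]

/-- A left eigenvector annihilating the input vector obstructs controllability. -/
theorem not_systemControllable_of_eigenvector {A : Matrix V V ℝ} {b v : V → ℝ} {μ : ℝ}
    (hv : v ᵥ* A = μ • v) (hb : v ⬝ᵥ b = 0) (hv0 : v ≠ 0) : ¬ SystemControllable A b := by
  intro h
  obtain ⟨T, hT, u, x, -, hx0, hxT, hx⟩ := h 0 v
  -- The input is invisible to `v`, so `exp (-μ t) * (v ⬝ᵥ x t)` is conserved; it is 0 at the start,
  -- so `v` itself cannot be reached.
  have hd : ∀ t ∈ Set.Icc 0 T, HasDerivWithinAt (fun t => Real.exp (-μ * t) * (v ⬝ᵥ x t)) 0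
      (Set.Icc 0 T) t := by
    intro t ht
    have h1 : HasDerivWithinAt (fun t => v ⬝ᵥ x t) (μ * (v ⬝ᵥ x t)) (Set.Icc 0 T) t := by
      have h2 : HasDerivWithinAt (fun t => v ⬝ᵥ x t) (v ⬝ᵥ (A.mulVec (x t) + u t • b))
          (Set.Icc 0 T) t := by
        simp only [dotProduct]
        exact HasDerivWithinAt.fun_sum fun i _ =>
          ((hasDerivWithinAt_pi.1 (hx t ht)) i).const_mul (v i)
      convert h2 using 1
      rw [dotProduct_add, dotProduct_smul, hb, dotProduct_mulVec, hv, smul_dotProduct]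
      simp
    have h3 : HasDerivWithinAt (fun t => Real.exp (-μ * t)) (Real.exp (-μ * t) * (-μ))
        (Set.Icc 0 T) t := by
      have := ((hasDerivAt_id t).const_mul (-μ)).exp.hasDerivWithinAt (s := Set.Icc 0 T)
      simpa using this
    exact (h3.mul h1).congr_deriv (by ring)
  have hc := constant_of_derivWithin_zero (f := fun t => Real.exp (-μ * t) * (v ⬝ᵥ x t))
    (fun t ht => (hd t ht).differentiableWithinAt)
    (fun t ht => (hd t (Set.Ico_subset_Icc_self ht)).derivWithin
      (uniqueDiffOn_Icc hT t (Set.Ico_subset_Icc_self ht))) T (Set.right_mem_Icc.2 hT.le)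
  simp only [hx0, hxT, dotProduct_zero, mul_zero, mul_eq_zero, Real.exp_ne_zero, false_or] at hc
  exact hv0 (dotProduct_self_eq_zero.1 hc)

/-- A nonzero invariant subspace of a real symmetric matrix contains an eigenvector. -/
theorem exists_eigenvector_mem_of_invariant {A : Matrix V V ℝ} (hA : A.IsSymm)
    {W : Submodule ℝ (V → ℝ)} (hW : ∀ w ∈ W, A *ᵥ w ∈ W) (hne : W ≠ ⊥) :
    ∃ μ : ℝ, ∃ w ∈ W, w ≠ 0 ∧ A *ᵥ w = μ • w := by
  classical
  set e := WithLp.linearEquiv 2 ℝ (V → ℝ)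
  set W' : Submodule ℝ (EuclideanSpace ℝ V) := W.comap e.toLinearMap
  set T : EuclideanSpace ℝ V →ₗ[ℝ] EuclideanSpace ℝ V := Matrix.toEuclideanLin A
  have hT : T.IsSymmetric := by
    rw [Matrix.isSymmetric_toEuclideanLin_iff]
    simpa [Matrix.IsHermitian, Matrix.conjTranspose_eq_transpose_of_trivial] using! hA
  have hT' : ∀ w ∈ W', T w ∈ W' := fun w hw => hW _ hw
  have hS := hT.restrict_invariant hT'
  by_contra hcon
  push Not at hcon
  have hno : ∀ μ : ℝ, Module.End.eigenspace (T.restrict hT') μ = ⊥ := by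
    intro μ
    rw [eq_bot_iff]
    intro w hw
    rw [Module.End.mem_eigenspace_iff] at hw
    by_contra hw0
    refine hcon μ (e w) w.2 ?_ ?_
    · intro h0
      apply hw0
      have : (w : EuclideanSpace ℝ V) = 0 := e.map_eq_zero_iff.1 h0
      simpa using this
    · have := congrArg (fun z : W' => e (z : EuclideanSpace ℝ V)) hw
      simpa using! this
  have hsub := hS.subsingleton_of_no_eigenvalue_finiteDimensional hno
  apply hne
  rw [eq_bot_iff]
  intro w hw
  have h1 : (⟨e.symm w, by simpa [W'] using hw⟩ : W') = 0 := Subsingleton.elim _ _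
  have h2 := congrArg (fun z : W' => e (z : EuclideanSpace ℝ V)) h1
  simpa using h2

/-- If no eigenvector of a symmetric matrix is orthogonal to `b`, then no proper invariant subspace
contains `b`. -/
theorem eq_top_of_invariant_of_mem {A : Matrix V V ℝ} (hA : A.IsSymm) {b : V → ℝ}
    (hb : ∀ (μ : ℝ) (v : V → ℝ), A *ᵥ v = μ • v → v ⬝ᵥ b = 0 → v = 0)
    {N : Submodule ℝ (V → ℝ)} (hN : ∀ z ∈ N, A *ᵥ z ∈ N) (hbN : b ∈ N) : N = ⊤ := by
  classical
  by_contra hne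
  obtain ⟨f, hf0, hf⟩ := N.exists_le_ker_of_lt_top (lt_top_iff_ne_top.2 hne)
  -- The orthogonal complement of `N`: invariant by symmetry of `A`, and nonzero when `N` is proper.
  -- An eigenvector in it would be orthogonal to `b`.
  let W : Submodule ℝ (V → ℝ) :=
    { carrier := {w | ∀ z ∈ N, w ⬝ᵥ z = 0}
      add_mem' := fun {w w'} h h' z hz => by rw [add_dotProduct, h z hz, h' z hz, add_zero]
      zero_mem' := fun z _ => zero_dotProduct z
      smul_mem' := fun c w h z hz => by rw [smul_dotProduct, h z hz, smul_zero] }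
  have hW : ∀ w ∈ W, A *ᵥ w ∈ W := by
    intro w hw z hz
    rw [dotProduct_comm, dotProduct_mulVec, ← mulVec_transpose, hA.eq, dotProduct_comm]
    exact hw _ (hN z hz)
  have hfw : ∀ z, f z = (fun i => f (Pi.single i 1)) ⬝ᵥ z := by
    intro z
    conv_lhs => rw [← (Pi.basisFun ℝ V).sum_repr z]
    simp [dotProduct, mul_comm]
  have hWne : W ≠ ⊥ := by
    intro h
    apply hf0
    have hmem : (fun i => f (Pi.single i 1)) ∈ W := fun z hz => by
      rw [← hfw]; exact hf hz
    rw [h, Submodule.mem_bot] at hmem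
    refine LinearMap.ext fun z => ?_
    rw [hfw, hmem, zero_dotProduct, LinearMap.zero_apply]
  obtain ⟨μ, w, hw, hw0, he⟩ := exists_eigenvector_mem_of_invariant hA hW hWne
  exact hw0 (hb μ w he (hw b hbN))

/-- Two-point Hermite interpolation at `0` and `1`. -/
theorem exists_polynomial_iterate_derivative_eval (n : ℕ) (c d : ℕ → ℝ) :
    ∃ y : ℝ[X], ∀ k < n, (derivative^[k] y).eval 0 = c k ∧ (derivative^[k] y).eval 1 = d k := by
  have taylor : ∀ (a : ℝ) (c : ℕ → ℝ), ∃ P : ℝ[X], ∀ k < n, (derivative^[k] P).eval a = c k := by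
    intro a c
    refine ⟨∑ j ∈ Finset.range n, C (c j / j.factorial) * (X - C a) ^ j, fun k hk => ?_⟩
    rw [Polynomial.iterate_derivative_sum, eval_finsetSum,
      Finset.sum_eq_single_of_mem k (Finset.mem_range.2 hk)]
    · rw [iterate_derivative_C_mul, iterate_derivative_X_sub_pow_self]
      simp [Nat.factorial_ne_zero]
    · intro j _ hj
      rw [iterate_derivative_C_mul, iterate_derivative_X_sub_pow]
      rcases lt_or_gt_of_ne hj with h | h
      · simp [Nat.descFactorial_of_lt h]
      · simp [Nat.sub_ne_zero_of_lt h]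
  obtain ⟨P, hP⟩ := taylor 0 c
  obtain ⟨Q, hQ⟩ := taylor 1 d
  have hcop : IsCoprime ((X - C (0 : ℝ)) ^ n) ((X - C (1 : ℝ)) ^ n) :=
    (isCoprime_X_sub_C_of_isUnit_sub (by simp)).pow
  obtain ⟨u, v, huv⟩ := hcop
  have vanish : ∀ (a : ℝ) (R : ℝ[X]), ∀ k < n, (derivative^[k] (R * (X - C a) ^ n)).eval a = 0 := by
    intro a R k hk
    obtain ⟨S, hS⟩ := pow_sub_dvd_iterate_derivative_of_pow_dvd k
      (Dvd.intro_left R rfl : (X - C a) ^ n ∣ R * (X - C a) ^ n)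
    rw [hS]
    simp [Nat.sub_ne_zero_of_lt hk]
  -- This agrees with `P` to order `n` at 0; by the Bézout relation it also equals `Q` plus a
  -- multiple of `(X - 1) ^ n`.
  refine ⟨P + (Q - P) * u * (X - C 0) ^ n, fun k hk => ⟨?_, ?_⟩⟩
  · rw [iterate_map_add, eval_add, vanish 0 _ k hk, hP k hk, add_zero]
  · have : P + (Q - P) * u * (X - C 0) ^ n = Q + (P - Q) * v * (X - C 1) ^ n := by
      linear_combination (Q - P) * huv
    rw [this, iterate_map_add, eval_add, vanish 1 _ k hk, hQ k hk, add_zero]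

/-- Sufficiency in the Hautus test for a symmetric state matrix. -/
theorem systemControllable_of_eigenvector [DecidableEq V] {A : Matrix V V ℝ} (hA : A.IsSymm)
    {b : V → ℝ} (hb : ∀ (μ : ℝ) (v : V → ℝ), A *ᵥ v = μ • v → v ⬝ᵥ b = 0 → v = 0) :
    SystemControllable A b := by
  set n := Fintype.card V
  set p := A.charpoly
  -- Horner truncations of the characteristic polynomial. The vectors `H k = g k (A) b` put the
  -- system in controller form: `H 0 = 0` by Cayley–Hamilton, `H n = b`, and `A` shifts the index
  -- down modulo `b`.
  let g : ℕ → ℝ[X] := fun k => divX^[k] p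
  have hgc : ∀ k i, (g k).coeff i = p.coeff (i + k) := by
    intro k
    induction k with
    | zero => intro i; rfl
    | succ k ih =>
      intro i
      simp only [g, Function.iterate_succ_apply']
      rw [coeff_divX]
      exact (ih (i + 1)).trans (by congr 1; omega)
  have hgs : ∀ k, g k = g (k + 1) * X + C (p.coeff k) := by
    intro k
    have h := divX_mul_X_add (g k)
    rw [hgc k 0, zero_add] at h
    simp only [g, Function.iterate_succ_apply'] at h ⊢
    exact h.symm
  have hdeg : p.natDegree = n := A.charpoly_natDegree_eq_dim
  have hgn : g n = 1 := by
    ext i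
    rw [hgc, coeff_one]
    rcases Nat.eq_zero_or_pos i with rfl | hi
    · have := A.charpoly_monic.coeff_natDegree
      simp only [if_true]
      rwa [zero_add, ← hdeg]
    · rw [if_neg (by omega), coeff_eq_zero_of_natDegree_lt (by omega)]
  let H : ℕ → V → ℝ := fun k => aeval A (g k) *ᵥ b
  have hH0 : H 0 = 0 := by
    simp only [H]
    have : aeval A (g 0) = 0 := A.aeval_self_charpoly
    rw [this, zero_mulVec]
  have hHn : H n = b := by simp [H, hgn]
  have hHs : ∀ k, A *ᵥ H (k + 1) = H k - p.coeff k • b := by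
    intro k
    have h1 : H k = A *ᵥ H (k + 1) + p.coeff k • b := by
      simp only [H]
      conv_lhs => rw [hgs k, mul_comm]
      rw [map_add, map_mul, aeval_X, aeval_C, add_mulVec, ← mulVec_mulVec,
        Algebra.algebraMap_eq_smul_one, smul_mulVec, one_mulVec]
    rw [h1, add_sub_cancel_right]
  have hspan : ∀ z : V → ℝ, ∃ c : ℕ → ℝ, ∑ k ∈ Finset.range n, c k • H (k + 1) = z := by
    intro z
    let N : Submodule ℝ (V → ℝ) := Submodule.span ℝ ((fun k => H (k + 1)) '' (Finset.range n : Set ℕ))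
    have hmem : ∀ k ≤ n, H k ∈ N := by
      intro k hk
      rcases Nat.eq_zero_or_pos k with rfl | hk0
      · rw [hH0]; exact N.zero_mem
      · refine Submodule.subset_span ⟨k - 1, ?_, ?_⟩
        · simp only [Finset.coe_range, Set.mem_Iio]; omega
        · simp only [Nat.sub_add_cancel hk0]
    have hbN : b ∈ N := hHn ▸ hmem n le_rfl
    have hN : N = ⊤ := by
      refine eq_top_of_invariant_of_mem hA hb (fun z hz => ?_) hbN
      induction hz using Submodule.span_induction with
      | mem z hz =>
        obtain ⟨k, hk, rfl⟩ := hz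
        simp only [Finset.coe_range, Set.mem_Iio] at hk
        simp only [hHs]
        exact N.sub_mem (hmem k hk.le) (N.smul_mem _ hbN)
      | zero => rw [mulVec_zero]; exact N.zero_mem
      | add z w _ _ hz hw => rw [mulVec_add]; exact N.add_mem hz hw
      | smul r z _ hz => rw [mulVec_smul]; exact N.smul_mem _ hz
    have hz : z ∈ N := hN ▸ Submodule.mem_top
    obtain ⟨c, hc⟩ := (Submodule.mem_span_image_finset_iff_exists_fun ℝ).1 hz
    refine ⟨fun k => if h : k ∈ Finset.range n then c ⟨k, h⟩ else 0, ?_⟩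
    rw [← hc, ← Finset.sum_coe_sort (Finset.range n)]
    simp
  intro xi xf
  obtain ⟨c, hc⟩ := hspan xi
  obtain ⟨d, hd⟩ := hspan xf
  obtain ⟨y, hy⟩ := exists_polynomial_iterate_derivative_eval n c d
  let Y : ℕ → ℝ → ℝ := fun k t => (derivative^[k] y).eval t
  have hYd : ∀ k t, HasDerivAt (Y k) (Y (k + 1) t) t := by
    intro k t
    simp only [Y, Function.iterate_succ_apply']
    exact (derivative^[k] y).hasDerivAt t
  have hYc : ∀ k, Continuous (Y k) := fun k => (derivative^[k] y).continuous
  -- Flatness: state and input are both read off from one polynomial `y` and its derivatives. The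
  -- states at times 0 and 1 fix only the derivatives of order below `n`, which Hermite
  -- interpolation prescribes.
  refine ⟨1, one_pos, fun t => Y n t + ∑ k ∈ Finset.range n, Y k t * p.coeff k,
    fun t => ∑ k ∈ Finset.range n, Y k t • H (k + 1), ?_, ?_, ?_, ?_⟩
  · fun_prop
  · rw [← hc]
    exact Finset.sum_congr rfl fun k hk => by rw [← (hy k (Finset.mem_range.1 hk)).1]
  · rw [← hd]
    exact Finset.sum_congr rfl fun k hk => by rw [← (hy k (Finset.mem_range.1 hk)).2]
  · intro t _
    have h1 : HasDerivAt (fun t => ∑ k ∈ Finset.range n, Y k t • H (k + 1))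
        (∑ k ∈ Finset.range n, Y (k + 1) t • H (k + 1)) t :=
      HasDerivAt.fun_sum fun k _ => (hYd k t).smul_const _
    refine h1.hasDerivWithinAt.congr_deriv ?_
    have h2 : ∑ k ∈ Finset.range n, (Y (k + 1) t • H (k + 1) - Y k t • H k)
        = Y n t • H n - Y 0 t • H 0 := Finset.sum_range_sub (fun k => Y k t • H k) n
    rw [hH0, hHn, smul_zero, sub_zero, Finset.sum_sub_distrib, sub_eq_iff_eq_add] at h2
    rw [h2, mulVec_sum, add_smul, Finset.sum_smul, add_left_comm, ← Finset.sum_add_distrib]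
    congr 1
    refine Finset.sum_congr rfl fun k _ => ?_
    rw [mulVec_smul, hHs, smul_sub, smul_smul, sub_add_cancel]

end Controllability

/-! ### Eigenvalues and eigenvectors of one antiregular graph. -/

section AntiregularSpectrum

/-- The operator `L - μ` on (the first `k` entries of) a sequence, with `L` the Laplacian of the
antiregular graph on `k` vertices. -/
def antiregularOp (k : ℕ) (μ : ℝ) (Y : ℕ → ℝ) (i : ℕ) : ℝ :=
  ((k : ℝ) - i - μ) * Y i - ∑ j ∈ Finset.range (k - i), Y j

theorem antiregularOp_sub_smul (k : ℕ) (μ t : ℝ) (Y Z : ℕ → ℝ) (i : ℕ) :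
    antiregularOp k μ (fun j => Y j - t * Z j) i
      = antiregularOp k μ Y i - t * antiregularOp k μ Z i := by
  simp only [antiregularOp, Finset.sum_sub_distrib, ← Finset.mul_sum]
  ring

theorem antiregularOp_smul (k : ℕ) (μ t : ℝ) (Y : ℕ → ℝ) (i : ℕ) :
    antiregularOp k μ (fun j => t * Y j) i = t * antiregularOp k μ Y i := by
  simp only [antiregularOp, ← Finset.mul_sum]
  ring

/-- The condition `j < k - i` is symmetric in `i` and `j`. Pairing with constants, eigenvectors or
responses gives the sum rule, the solvability conditions and reciprocity. -/
theorem antiregularOp_symm (k : ℕ) (μ : ℝ) (Y Z : ℕ → ℝ) :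
    ∑ i ∈ Finset.range k, Z i * antiregularOp k μ Y i
      = ∑ i ∈ Finset.range k, Y i * antiregularOp k μ Z i := by
  simp only [antiregularOp, mul_sub, Finset.sum_sub_distrib, Finset.mul_sum]
  congr 1
  · exact Finset.sum_congr rfl fun i _ => by ring
  · rw [Finset.sum_comm' (t' := Finset.range k) (s' := fun j => Finset.range (k - j))]
    · exact Finset.sum_congr rfl fun i _ => Finset.sum_congr rfl fun j _ => mul_comm _ _
    · intro i j
      simp only [Finset.mem_range]
      omega

theorem antiregularOp_one {k : ℕ} (μ : ℝ) {i : ℕ} (hi : i < k) :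
    antiregularOp k μ (fun _ => 1) i = -μ := by
  simp only [antiregularOp, Finset.sum_const, Finset.card_range, nsmul_eq_mul, mul_one]
  rw [Nat.cast_sub hi.le]
  ring

/-- Summing all the rows of `(L - μ) Y`. -/
theorem sum_antiregularOp (k : ℕ) (μ : ℝ) (Y : ℕ → ℝ) :
    ∑ i ∈ Finset.range k, antiregularOp k μ Y i = -μ * ∑ i ∈ Finset.range k, Y i := by
  have h := antiregularOp_symm k μ Y (fun _ => 1)
  simp only [one_mul] at h
  rw [h, Finset.mul_sum]
  refine Finset.sum_congr rfl fun i hi => ?_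
  rw [antiregularOp_one μ (Finset.mem_range.1 hi), mul_comm]

/-- The eigenvector of the Laplacian of the antiregular graph with eigenvalue `k - j`, for
`j ≠ k / 2`. -/
def antiregularEigenvector (k j i : ℕ) : ℝ :=
  if j < k / 2 then
    if i = j then 2 * (j : ℝ) + 1 - k else if j < i ∧ i < k - j then 1 else 0
  else if i = j then (k : ℝ) - 2 * j else if k - j ≤ i ∧ i < j then 1 else 0

/-- Each row of the operator sees a vector only through one entry and one initial partial sum, so
this closed form reduces the eigenvector equation to a case check. -/
theorem sum_range_antiregularEigenvector {k j : ℕ} (hj : j < k) (hc : j ≠ k / 2) (m : ℕ) :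
    ∑ i ∈ Finset.range m, antiregularEigenvector k j i =
      if j < k / 2 then if j < m ∧ m < k - j then (m : ℝ) - k + j else 0
      else if k - j ≤ m ∧ m ≤ j then (m : ℝ) + j - k else 0 := by
  induction m with
  | zero =>
    rw [Finset.sum_range_zero]
    split_ifs <;> first | rfl | omega
  | succ m ih =>
    rw [Finset.sum_range_succ, ih, antiregularEigenvector]
    push_cast
    have h1 : m + 1 = k - j → (k : ℝ) = m + 1 + j := fun h => by
      exact_mod_cast (by omega : k = m + 1 + j)
    have h2 : m = k - j → (k : ℝ) = m + j := fun h => by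
      exact_mod_cast (by omega : k = m + j)
    have h3 : m = j → (m : ℝ) = j := fun h => by rw [h]
    split_ifs <;> first
      | omega
      | linarith
      | linarith [h1 (by omega)]
      | linarith [h3 (by omega)]

theorem antiregularOp_eigenvector {k j : ℕ} (hj : j < k) (hc : j ≠ k / 2) {i : ℕ} (hi : i < k) :
    antiregularOp k ((k : ℝ) - j) (antiregularEigenvector k j) i = 0 := by
  rw [antiregularOp, sum_range_antiregularEigenvector hj hc, antiregularEigenvector,
    Nat.cast_sub hi.le]
  rcases eq_or_ne i j with rfl | hij
  · split_ifs <;> first | omega | ring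
  · split_ifs <;> first | omega | ring

theorem antiregularEigenvector_self_ne_zero {k j : ℕ} (hc : j ≠ k / 2) :
    antiregularEigenvector k j j ≠ 0 := by
  rw [antiregularEigenvector, if_pos rfl, if_pos rfl]
  split_ifs with h
  · have : ((2 * j + 1 : ℕ) : ℝ) < k := by exact_mod_cast (by omega)
    push_cast at this
    linarith
  · have : (k : ℝ) < ((2 * j : ℕ) : ℝ) := by exact_mod_cast (by omega)
    push_cast at this
    linarith

theorem antiregularEigenvector_nonneg {k j i : ℕ} (hij : i ≠ j) :
    0 ≤ antiregularEigenvector k j i := by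
  rw [antiregularEigenvector]
  split_ifs <;> norm_num

theorem sum_antiregularEigenvector {k j : ℕ} (hj : j < k) (hc : j ≠ k / 2) :
    ∑ i ∈ Finset.range k, antiregularEigenvector k j i = 0 := by
  rw [sum_range_antiregularEigenvector hj hc]
  split_ifs <;> first | rfl | omega

/-- A null vector of `L - μ` with zero sum vanishes as soon as it vanishes at the vertices belonging
to the eigenvalue `μ`. -/
theorem eq_zero_of_antiregularOp_eq_zero {k : ℕ} {μ : ℝ} {Y : ℕ → ℝ}
    (hY : ∀ i < k, antiregularOp k μ Y i = 0) (hsum : ∑ i ∈ Finset.range k, Y i = 0)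
    (hμ : ∀ j < k, j ≠ k / 2 → (k : ℝ) - j = μ → Y j = 0) : ∀ i < k, Y i = 0 := by
  -- Peel from both ends inwards. Once the outer entries vanish, the sum in row `i` is the total
  -- sum, which is 0, and the sum in row `k - 1 - i` reduces to `Y i`. Only the entry at `k / 2`
  -- escapes, and the zero sum takes care of it.
  have key : ∀ i < k / 2, Y i = 0 ∧ (k - 1 - i ≠ k / 2 → Y (k - 1 - i) = 0) := by
    intro i
    induction i using Nat.strong_induction_on with
    | _ i ih =>
      intro hi
      have hi0 : Y i = 0 := by
        by_cases h : (k : ℝ) - i = μ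
        · exact hμ i (by omega) (by omega) h
        · have hrow := hY i (by omega)
          have hS : ∑ j ∈ Finset.range (k - i), Y j = ∑ j ∈ Finset.range k, Y j := by
            refine Finset.sum_subset (Finset.range_mono (by omega)) fun j hj hj' => ?_
            simp only [Finset.mem_range] at hj hj'
            have := (ih (k - 1 - j) (by omega) (by omega)).2 (by omega)
            rwa [show k - 1 - (k - 1 - j) = j by omega] at this
          rw [antiregularOp, hS, hsum, sub_zero] at hrow
          exact (mul_eq_zero.1 hrow).resolve_left (sub_ne_zero.2 h)
      refine ⟨hi0, fun hc => ?_⟩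
      by_cases h : (k : ℝ) - ((k - 1 - i : ℕ) : ℝ) = μ
      · exact hμ _ (by omega) hc h
      · have hrow := hY (k - 1 - i) (by omega)
        rw [antiregularOp, Finset.sum_eq_zero, sub_zero] at hrow
        · exact (mul_eq_zero.1 hrow).resolve_left (sub_ne_zero.2 h)
        · intro j hj
          simp only [Finset.mem_range] at hj
          rcases eq_or_ne j i with rfl | hji
          · exact hi0
          · exact (ih j (by omega) (by omega)).1
  have hoff : ∀ i < k, i ≠ k / 2 → Y i = 0 := by
    intro i hi hc
    rcases lt_or_gt_of_ne hc with h | h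
    · exact (key i h).1
    · have := (key (k - 1 - i) (by omega)).2 (by omega)
      rwa [show k - 1 - (k - 1 - i) = i by omega] at this
  intro i hi
  by_cases hc : i = k / 2
  · rw [← hsum]
    exact (Finset.sum_eq_single_of_mem i (Finset.mem_range.2 hi) fun j hj hji =>
      hoff j (Finset.mem_range.1 hj) (by omega)).symm
  · exact hoff i hi hc

/-- The null vectors of `L - μ`. -/
theorem antiregularOp_eq_zero_cases {k : ℕ} {μ : ℝ} {Y : ℕ → ℝ}
    (hY : ∀ i < k, antiregularOp k μ Y i = 0) :
    (∃ t, ∀ i < k, Y i = t) ∨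
      ∃ j < k, j ≠ k / 2 ∧ ∃ t, ∀ i < k, Y i = t * antiregularEigenvector k j i := by
  by_cases h0 : μ = 0
  · left
    subst h0
    refine ⟨Y 0, ?_⟩
    have hZ : ∀ i < k, antiregularOp k 0 (fun i => Y i - Y 0 * 1) i = 0 := fun i hi => by
      rw [antiregularOp_sub_smul, hY i hi, antiregularOp_one 0 hi]; ring
    intro i hi
    have hrow := hZ 0 (by omega)
    have := eq_zero_of_antiregularOp_eq_zero hZ
      (by simpa only [antiregularOp, mul_one, sub_self, mul_zero, zero_sub, neg_eq_zero,
        Nat.sub_zero] using hrow)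
      (fun j hj _ h => absurd h (sub_ne_zero.2 (by exact_mod_cast hj.ne'))) i hi
    linarith
  · have hsum : ∀ Z : ℕ → ℝ, (∀ i < k, antiregularOp k μ Z i = 0) →
        ∑ i ∈ Finset.range k, Z i = 0 := by
      intro Z hZ
      have := sum_antiregularOp k μ Z
      rw [Finset.sum_eq_zero fun i hi => hZ i (Finset.mem_range.1 hi)] at this
      exact (mul_eq_zero.1 this.symm).resolve_left (neg_ne_zero.2 h0)
    by_cases hj : ∃ j < k, j ≠ k / 2 ∧ (k : ℝ) - j = μ
    · right
      obtain ⟨j, hj, hc, hμ⟩ := hj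
      refine ⟨j, hj, hc, Y j / antiregularEigenvector k j j, fun i hi => ?_⟩
      set t := Y j / antiregularEigenvector k j j with ht
      have hZ : ∀ i < k,
          antiregularOp k μ (fun i => Y i - t * antiregularEigenvector k j i) i = 0 := by
        intro i hi
        have h1 := antiregularOp_eigenvector hj hc hi
        rw [hμ] at h1
        rw [antiregularOp_sub_smul, hY i hi, h1]
        ring
      refine sub_eq_zero.1 (eq_zero_of_antiregularOp_eq_zero hZ (hsum _ hZ)
        (fun j' _ _ h => ?_) i hi)
      have : j' = j := by
        have : (j' : ℝ) = j := by linarith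
        exact_mod_cast this
      subst this
      rw [ht, div_mul_cancel₀ _ (antiregularEigenvector_self_ne_zero hc), sub_self]
    · left
      push Not at hj
      exact ⟨0, eq_zero_of_antiregularOp_eq_zero hY (hsum Y hY) fun j h1 h2 h3 =>
        absurd h3 (hj j h1 h2)⟩

/-- The support is the interval `[j, k - j)` or `[k - j, j]`, and either one contains both middle
vertices. -/
theorem antiregularEigenvector_twin_ne_zero {k j i : ℕ} (hk : 2 ≤ k) (hc : j ≠ k / 2) (hj : j < k)
    (hi : i = (k + 1) / 2 - 1 ∨ i = (k + 1) / 2) : antiregularEigenvector k j i ≠ 0 := by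
  rcases eq_or_ne i j with rfl | hij
  · exact antiregularEigenvector_self_ne_zero hc
  · rw [antiregularEigenvector]
    split_ifs <;> first | omega | norm_num

/-- No eigenvector is orthogonal to a `0`-`1` vector which takes both values on the two
degree-repeating vertices. -/
theorem eq_zero_of_antiregularOp_eq_zero_of_sum_eq_zero {k : ℕ} (hk : 2 ≤ k) {μ : ℝ}
    {b Y : ℕ → ℝ} (hb : ∀ i < k, b i = 0 ∨ b i = 1)
    (hb1 : b ((k + 1) / 2 - 1) + b ((k + 1) / 2) = 1)
    (hY : ∀ i < k, antiregularOp k μ Y i = 0) (hbY : ∑ i ∈ Finset.range k, b i * Y i = 0) :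
    ∀ i < k, Y i = 0 := by
  have hne : ∀ a : ℝ, (a = 0 ∨ a = 1) →
      ∃ i, (i = (k + 1) / 2 - 1 ∨ i = (k + 1) / 2) ∧ b i ≠ a := by
    intro a ha
    by_contra! hcon
    rw [hcon _ (Or.inl rfl), hcon _ (Or.inr rfl)] at hb1
    rcases ha with rfl | rfl <;> norm_num at hb1
  rcases antiregularOp_eq_zero_cases hY with ⟨t, ht⟩ | ⟨j, hj, hc, t, ht⟩
  · obtain ⟨i, hi, hbi⟩ := hne 0 (Or.inl rfl)
    have hpos : 0 < ∑ i ∈ Finset.range k, b i :=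
      Finset.sum_pos' (fun i hi => by
        rcases hb i (Finset.mem_range.1 hi) with h | h <;> norm_num [h])
        ⟨i, Finset.mem_range.2 (by omega), by
          rcases hb i (by omega) with h | h
          · exact absurd h hbi
          · rw [h]; norm_num⟩
    rw [Finset.sum_congr rfl fun i hi => by rw [ht i (Finset.mem_range.1 hi)],
      ← Finset.sum_mul] at hbY
    rw [(mul_eq_zero.1 hbY).resolve_left hpos.ne'] at ht
    exact ht
  -- The eigenvector has zero sum, so `b j` may be subtracted from `b`. This removes the only
  -- possibly negative entry; the remaining terms share one sign, and a twin where `b` differs from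
  -- `b j` contributes strictly.
  · have hsum : ∑ i ∈ Finset.range k, b i * antiregularEigenvector k j i
        = ∑ i ∈ Finset.range k, (b i - b j) * antiregularEigenvector k j i := by
      simp only [sub_mul, Finset.sum_sub_distrib]
      rw [← Finset.mul_sum, sum_antiregularEigenvector hj hc]
      ring
    obtain ⟨i, hi, hbi⟩ := hne (b j) (hb j hj)
    have hij : i ≠ j := fun h => hbi (by rw [h])
    have hik : i < k := by omega
    have hv : 0 < antiregularEigenvector k j i :=
      lt_of_le_of_ne (antiregularEigenvector_nonneg hij)
        (antiregularEigenvector_twin_ne_zero hk hc hj hi).symm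
    have hdot : ∑ i ∈ Finset.range k, b i * antiregularEigenvector k j i ≠ 0 := by
      rw [hsum]
      rcases hb j hj with h | h
      · refine (Finset.sum_pos' (fun l hl => ?_) ⟨i, Finset.mem_range.2 hik, ?_⟩).ne'
        · rcases eq_or_ne l j with rfl | hlj
          · simp
          · refine mul_nonneg ?_ (antiregularEigenvector_nonneg hlj)
            rcases hb l (Finset.mem_range.1 hl) with h' | h' <;> rw [h, h'] <;> norm_num
        · refine mul_pos ?_ hv
          rcases hb i hik with h' | h'
          · exact absurd (h'.trans h.symm) hbi
          · rw [h, h']; norm_num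
      · rw [← neg_ne_zero, ← Finset.sum_neg_distrib]
        refine (Finset.sum_pos' (fun l hl => ?_) ⟨i, Finset.mem_range.2 hik, ?_⟩).ne'
        · rcases eq_or_ne l j with rfl | hlj
          · simp
          · rw [← neg_mul]
            refine mul_nonneg ?_ (antiregularEigenvector_nonneg hlj)
            rcases hb l (Finset.mem_range.1 hl) with h' | h' <;> rw [h, h'] <;> norm_num
        · rw [← neg_mul]
          refine mul_pos ?_ hv
          rcases hb i hik with h' | h'
          · rw [h, h']; norm_num
          · exact absurd (h'.trans h.symm) hbi
    rw [Finset.sum_congr rfl fun i hi => by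
      rw [ht i (Finset.mem_range.1 hi), mul_left_comm], ← Finset.mul_sum] at hbY
    rw [(mul_eq_zero.1 hbY).resolve_right hdot] at ht
    intro i hi
    rw [ht i hi, zero_mul]

/-- No eigenvector vanishes at the first degree-repeating vertex. -/
theorem eq_zero_of_antiregularOp_eq_zero_of_twin {k : ℕ} (hk : 2 ≤ k) {μ : ℝ} {Y : ℕ → ℝ}
    (hY : ∀ i < k, antiregularOp k μ Y i = 0) (h0 : Y ((k + 1) / 2 - 1) = 0) :
    ∀ i < k, Y i = 0 := by
  refine eq_zero_of_antiregularOp_eq_zero_of_sum_eq_zero hk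
    (b := fun i => if i = (k + 1) / 2 - 1 then 1 else 0) (fun i _ => ?_) ?_ hY ?_
  · by_cases h : i = (k + 1) / 2 - 1 <;> simp [h]
  · rw [if_pos rfl, if_neg (by omega), add_zero]
  · simp [h0]

end AntiregularSpectrum

/-! ### Responses of one copy to excitation at an end or at a twin. -/

section AntiregularResponse

/-- The solution of `(L - μ) w = e` for the antiregular graph, with `e` the unit vector of the
dominating or terminal vertex. -/
noncomputable def endResponse (k : ℕ) (μ : ℝ) : LinkEnd → ℕ → ℝ
  | .dominating, i => if i = 0 then (μ - 1) / (μ * (k - μ)) else -1 / (μ * (k - μ))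
  | .terminal, i =>
    if i = 0 then -1 / (μ * (k - μ))
    else if i = k - 1 then (1 - 1 / (μ * (k - μ))) / (1 - μ)
    else -1 / (μ * (k - μ)) / (1 - μ)

theorem sum_range_of_eq_on_pos {Y : ℕ → ℝ} {t : ℝ} {m : ℕ} (hm : 0 < m)
    (hY : ∀ i < m, i ≠ 0 → Y i = t) : ∑ i ∈ Finset.range m, Y i = Y 0 + (m - 1) * t := by
  obtain ⟨m, rfl⟩ := Nat.exists_eq_succ_of_ne_zero hm.ne'
  rw [Nat.succ_eq_add_one, Finset.sum_range_succ', Finset.sum_congr rfl fun i hi =>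
    hY (i + 1) (Nat.succ_lt_succ (Finset.mem_range.1 hi)) (Nat.succ_ne_zero i)]
  simp
  ring

theorem antiregularOp_endResponse {k : ℕ} (hk : 3 ≤ k) {μ : ℝ} (h0 : μ ≠ 0) (h1 : μ ≠ 1)
    (hμk : μ ≠ k) (e : LinkEnd) {i : ℕ} (hi : i < k) :
    antiregularOp k μ (endResponse k μ e) i = if i = e.pos k then 1 else 0 := by
  have h1' : 1 - μ ≠ 0 := sub_ne_zero.2 h1.symm
  have hk' : (k : ℝ) - μ ≠ 0 := sub_ne_zero.2 hμk.symm
  rw [antiregularOp]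
  cases e with
  | dominating =>
    rw [sum_range_of_eq_on_pos (t := -1 / (μ * (k - μ))) (by omega)
      (fun j _ hj => by simp [endResponse, hj]), Nat.cast_sub hi.le]
    rcases eq_or_ne i 0 with rfl | hi0
    · simp [endResponse, LinkEnd.pos]
      field_simp
      ring
    · simp [endResponse, LinkEnd.pos, hi0]
      field_simp
      ring
  | terminal =>
    rcases eq_or_ne i 0 with rfl | hi0
    · obtain ⟨n, rfl⟩ : ∃ n, k = n + 1 := ⟨k - 1, by omega⟩
      rw [Nat.sub_zero, Finset.sum_range_succ, sum_range_of_eq_on_pos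
        (t := -1 / (μ * ((n + 1 : ℕ) - μ)) / (1 - μ)) (by omega)
        (fun j hj hj0 => by simp [endResponse, hj0, hj.ne])]
      have hn : n ≠ 0 := by omega
      push_cast at hk'
      simp [endResponse, LinkEnd.pos, hn, hn.symm]
      field_simp
      ring
    · rw [sum_range_of_eq_on_pos (t := -1 / (μ * (k - μ)) / (1 - μ)) (by omega)
        (fun j hj hj0 => by simp [endResponse, hj0, show j ≠ k - 1 by omega]),
        Nat.cast_sub hi.le]
      rcases eq_or_ne i (k - 1) with rfl | hik
      · rw [Nat.cast_sub (by omega : 1 ≤ k)]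
        simp [endResponse, LinkEnd.pos, hi0]
        field_simp
        ring
      · simp [endResponse, LinkEnd.pos, hi0, hik]
        field_simp
        ring

theorem endResponse_twin_ne_zero {k : ℕ} (hk : 3 ≤ k) {μ : ℝ} (h0 : μ ≠ 0) (h1 : μ ≠ 1)
    (hμk : μ ≠ k) (e : LinkEnd) : endResponse k μ e ((k + 1) / 2 - 1) ≠ 0 := by
  have h1' : 1 - μ ≠ 0 := sub_ne_zero.2 h1.symm
  have hk' : (k : ℝ) - μ ≠ 0 := sub_ne_zero.2 hμk.symm
  have ha : (k + 1) / 2 - 1 ≠ 0 := by omega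
  have hb : (k + 1) / 2 - 1 ≠ k - 1 := by omega
  cases e <;> simp only [endResponse, ha, hb, if_false] <;>
    simp [h0, h1', hk']

/-- `μ` is not an eigenvalue of the Laplacian of the antiregular graph. -/
def AntiregularRegularValue (k : ℕ) (μ : ℝ) : Prop :=
  ∀ Y : ℕ → ℝ, (∀ i < k, antiregularOp k μ Y i = 0) → ∀ i < k, Y i = 0

namespace AntiregularRegularValue

variable {k : ℕ} {μ : ℝ}

theorem ne_zero (h : AntiregularRegularValue k μ) (hk : 0 < k) : μ ≠ 0 := by
  rintro rfl
  exact one_ne_zero (h (fun _ => 1) (fun i hi => by rw [antiregularOp_one 0 hi, neg_zero]) 0 hk)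

theorem ne_sub (h : AntiregularRegularValue k μ) {j : ℕ} (hj : j < k) (hc : j ≠ k / 2) :
    μ ≠ k - j := by
  rintro rfl
  exact antiregularEigenvector_self_ne_zero hc
    (h _ (fun i hi => antiregularOp_eigenvector hj hc hi) j hj)

theorem ne_natCast (h : AntiregularRegularValue k μ) (hk : 2 ≤ k) : μ ≠ k := by
  simpa using h.ne_sub (j := 0) (by omega) (by omega)

theorem ne_one (h : AntiregularRegularValue k μ) (hk : 3 ≤ k) : μ ≠ 1 := by
  have := h.ne_sub (j := k - 1) (by omega) (by omega)
  rw [Nat.cast_sub (by omega)] at this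
  simpa using this

/-- A positive integer up to `k` which is not an eigenvalue is equal to `⌈k / 2⌉`. -/
theorem eq_of_natCast {N : ℕ} (h : AntiregularRegularValue k N) (h1 : 0 < N) (hN : N ≤ k) :
    N = (k + 1) / 2 := by
  by_contra hne
  refine h.ne_sub (j := k - N) (by omega) (by omega) ?_
  rw [Nat.cast_sub hN]
  ring

theorem eq_smul_endResponse (h : AntiregularRegularValue k μ) (hk : 3 ≤ k) {e : LinkEnd} {t : ℝ}
    {Y : ℕ → ℝ} (hY : ∀ i < k, antiregularOp k μ Y i = -(if i = e.pos k then t else 0)) :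
    ∀ i < k, Y i = -t * endResponse k μ e i := by
  intro i hi
  refine sub_eq_zero.1 (h (fun i => Y i - -t * endResponse k μ e i) (fun i hi => ?_) i hi)
  rw [antiregularOp_sub_smul, hY i hi, antiregularOp_endResponse hk (h.ne_zero (by omega))
    (h.ne_one hk) (h.ne_natCast (by omega)) e hi]
  split_ifs <;> ring

/-- The response to an end excitation never vanishes at the first twin. This carries zero flow
forwards along the chain. -/
theorem eq_zero_of_twin (h : AntiregularRegularValue k μ) (hk : 3 ≤ k) {e : LinkEnd} {t : ℝ}
    {Y : ℕ → ℝ} (hY : ∀ i < k, antiregularOp k μ Y i = -(if i = e.pos k then t else 0))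
    (h0 : Y ((k + 1) / 2 - 1) = 0) : t = 0 := by
  rw [h.eq_smul_endResponse hk hY _ (by omega)] at h0
  simpa using (mul_eq_zero.1 h0).resolve_right (endResponse_twin_ne_zero hk (h.ne_zero (by omega))
    (h.ne_one hk) (h.ne_natCast (by omega)) e)

/-- A response to an excitation of an end vertex is orthogonal to the input vector only at the
exceptional value `⌈k / 2⌉`. -/
theorem eq_zero_or_eq_of_sum_eq_zero (h : AntiregularRegularValue k μ) (hk : 3 ≤ k) {e : LinkEnd}
    {t : ℝ} {b Y : ℕ → ℝ} (hb : ∀ i < k, b i = 0 ∨ b i = 1)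
    (hb1 : b ((k + 1) / 2 - 1) + b ((k + 1) / 2) = 1) (he : e = .terminal → b (k - 1) = 0)
    (hY : ∀ i < k, antiregularOp k μ Y i = -(if i = e.pos k then t else 0))
    (hbY : ∑ i ∈ Finset.range k, b i * Y i = 0) : t = 0 ∨ μ = ((k + 1) / 2 : ℕ) := by
  have h0 := h.ne_zero (by omega)
  have h1' : 1 - μ ≠ 0 := sub_ne_zero.2 (h.ne_one hk).symm
  have hk' : (k : ℝ) - μ ≠ 0 := sub_ne_zero.2 (h.ne_natCast (by omega)).symm
  refine or_iff_not_imp_left.2 fun ht => ?_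
  have hw : ∑ i ∈ Finset.range k, b i * endResponse k μ e i = 0 := by
    rw [Finset.sum_congr rfl fun i hi => by
      rw [h.eq_smul_endResponse hk hY i (Finset.mem_range.1 hi), mul_left_comm],
      ← Finset.mul_sum] at hbY
    exact (mul_eq_zero.1 hbY).resolve_left (neg_ne_zero.2 ht)
  -- Clearing denominators gives the same relation for both ends; for the terminal end, `b (k - 1) =
  -- 0` removes the one irregular entry. As `b` is a nonzero 0-1 vector, `μ` must be its number of
  -- ones, an integer in `[1, k]`.
  have hkey : b 0 * μ = ∑ i ∈ Finset.range k, b i := by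
    obtain ⟨n, rfl⟩ : ∃ n, k = n + 1 := ⟨k - 1, by omega⟩
    rw [Finset.sum_range_succ'] at hw ⊢
    cases e with
    | dominating =>
      simp only [endResponse, if_true, Nat.add_one_ne_zero, if_false, ← Finset.sum_mul] at hw
      field_simp at hw
      linarith
    | terminal =>
      have hlast : ∀ i ∈ Finset.range n, b (i + 1) * endResponse (n + 1) μ .terminal (i + 1)
          = b (i + 1) * (-1 / (μ * ((n + 1 : ℕ) - μ)) / (1 - μ)) := by
        intro i hi
        rcases eq_or_ne (i + 1) n with hin | hin
        · have := he rfl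
          simp only [Nat.add_sub_cancel] at this
          rw [hin, this, zero_mul, zero_mul]
        · simp [endResponse, hin]
      rw [Finset.sum_congr rfl hlast, ← Finset.sum_mul] at hw
      simp only [endResponse, if_true] at hw
      field_simp at hw
      linarith
  set N := ((Finset.range k).filter fun i => b i = 1).card with hN
  have hbN : ∑ i ∈ Finset.range k, b i = N := by
    rw [hN, Finset.natCast_card_filter]
    refine Finset.sum_congr rfl fun i hi => ?_
    rcases hb i (Finset.mem_range.1 hi) with h | h <;> simp [h]
  have hNpos : 0 < N := by
    rw [hN, Finset.card_pos]
    rcases hb ((k + 1) / 2 - 1) (by omega) with h | h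
    · exact ⟨(k + 1) / 2, Finset.mem_filter.2 ⟨Finset.mem_range.2 (by omega), by linarith⟩⟩
    · exact ⟨(k + 1) / 2 - 1, Finset.mem_filter.2 ⟨Finset.mem_range.2 (by omega), by linarith⟩⟩
  have hNk : N ≤ k := (Finset.card_filter_le _ _).trans (by simp)
  rw [hbN] at hkey
  rcases hb 0 (by omega) with hb0 | hb0
  · rw [hb0, zero_mul] at hkey
    exact absurd hkey.symm (by exact_mod_cast hNpos.ne')
  · rw [hb0, one_mul] at hkey
    subst hkey
    rw [← h.eq_of_natCast hNpos hNk]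

end AntiregularRegularValue

/-- Reciprocity between the ends and the first degree-repeating vertex. -/
theorem apply_pos_eq_of_antiregularOp_eq {k : ℕ} {μ : ℝ} (h : AntiregularRegularValue k μ)
    (hk : 3 ≤ k) (e : LinkEnd) {f : ℝ} {Y : ℕ → ℝ}
    (hY : ∀ i < k, antiregularOp k μ Y i = if i = (k + 1) / 2 - 1 then f else 0) :
    Y (e.pos k) = f * endResponse k μ e ((k + 1) / 2 - 1) := by
  have hs := antiregularOp_symm k μ Y (endResponse k μ e)
  have hw := fun i hi => antiregularOp_endResponse hk (h.ne_zero (by omega)) (h.ne_one hk)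
    (h.ne_natCast (by omega)) e (i := i) (Finset.mem_range.1 hi)
  rw [Finset.sum_congr rfl fun i hi => congrArg _ (hY i (Finset.mem_range.1 hi)),
    Finset.sum_congr rfl fun i hi => congrArg (Y i * ·) (hw i hi)] at hs
  have hp : e.pos k < k := by cases e <;> simp only [LinkEnd.pos] <;> omega
  have hq : (k + 1) / 2 - 1 < k := by omega
  simpa [hp, hq, mul_comm] using hs.symm

/-- Lower bound for the driving-point response at the exceptional value, `k` even. -/
theorem le_twin_response_even {d : ℕ} (hd : 1 ≤ d) {Y : ℕ → ℝ}
    (hY : ∀ i < 2 * d + 2, antiregularOp (2 * d + 2) (d + 1 : ℕ) Y i = if i = d then 1 else 0) :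
    1 / ((d : ℝ) + 1) ^ 2 ≤ Y d := by
  have hd' : (0 : ℝ) < d := by exact_mod_cast hd
  have row : ∀ i m, i + m = 2 * d + 2 → 0 < m → ((d : ℝ) + 1 - i) * Y i
      = (∑ j ∈ Finset.range m, Y j) + if i = d then 1 else 0 := by
    intro i m him hm
    have h := hY i (by omega)
    rw [antiregularOp, show 2 * d + 2 - i = m by omega] at h
    push_cast at h
    linarith
  have hsum := sum_antiregularOp (2 * d + 2) (d + 1 : ℕ) Y
  rw [Finset.sum_congr rfl fun i hi => hY i (Finset.mem_range.1 hi)] at hsum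
  simp only [Finset.sum_ite_eq', Finset.mem_range, show d < 2 * d + 2 by omega, if_true] at hsum
  push_cast at hsum
  have h0 := row 0 (2 * d + 2) (by omega) (by omega)
  rw [if_neg (by omega)] at h0
  have hY0 : Y 0 = -(1 / ((d : ℝ) + 1) ^ 2) := by
    field_simp
    push_cast at h0
    nlinarith
  -- Both bounds propagate inwards together. Row `2 * d + 1 - i` reads `(d - i) * Y (2 * d + 1 - i)
  -- = -(Y 0 + … + Y i)`, which is at least `-Y 0`; the difference of rows `i` and `i + 1` passes
  -- the sign on to `Y (i + 1)`.
  have key : ∀ i < d, Y i ≤ 0 ∧ 1 / ((d : ℝ) + 1) ^ 2 ≤ (d - i) * Y (2 * d + 1 - i) := by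
    intro i
    induction i with
    | zero =>
      intro _
      have hlast := row (2 * d + 1) 1 (by omega) (by omega)
      rw [if_neg (by omega), Finset.sum_range_one, add_zero] at hlast
      push_cast at hlast
      refine ⟨by rw [hY0]; exact neg_nonpos.2 (by positivity), ?_⟩
      rw [Nat.sub_zero]
      push_cast
      linarith
    | succ i ih =>
      intro hi
      obtain ⟨hp, hq⟩ := ih (by omega)
      have hid : ((i + 1 : ℕ) : ℝ) < d := by exact_mod_cast hi
      push_cast at hid
      have hqpos : 0 ≤ Y (2 * d + 1 - i) := by
        have : 0 ≤ (d - i) * Y (2 * d + 1 - i) := le_trans (by positivity) hq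
        exact nonneg_of_mul_nonneg_right this (by linarith)
      have r1 := row i (2 * d + 1 - i + 1) (by omega) (by omega)
      have r2 := row (i + 1) (2 * d + 1 - i) (by omega) (by omega)
      rw [Finset.sum_range_succ, if_neg (by omega)] at r1
      rw [if_neg (by omega)] at r2
      have hp' : Y (i + 1) ≤ 0 := by
        have h1 : ((d : ℝ) - i) * Y (i + 1) = (d + 1 - i) * Y i - Y (2 * d + 1 - i) := by
          push_cast at r2; linarith
        have h2 : ((d : ℝ) + 1 - i) * Y i ≤ 0 :=
          mul_nonpos_of_nonneg_of_nonpos (by linarith) hp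
        exact nonpos_of_mul_nonpos_right (by linarith : ((d : ℝ) - i) * Y (i + 1) ≤ 0)
          (by linarith)
      refine ⟨hp', ?_⟩
      have r3 := row (2 * d + 1 - i) (i + 1) (by omega) (by omega)
      have r4 := row (2 * d + 1 - (i + 1)) (i + 1 + 1) (by omega) (by omega)
      rw [if_neg (by omega), Nat.cast_sub (by omega)] at r3
      rw [Finset.sum_range_succ, if_neg (by omega), Nat.cast_sub (by omega)] at r4
      push_cast at r3 r4 ⊢
      linarith
  obtain ⟨d, rfl⟩ : ∃ c, d = c + 1 := ⟨d - 1, by omega⟩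
  have hk := (key d (by omega)).2
  -- At the exceptional value this row has diagonal coefficient 0, so the entries up to the first
  -- twin sum to 0. The next row identifies the sum of the entries before the twin.
  have r1 := row (d + 1 + 1) (d + 1 + 1) (by omega) (by omega)
  have r2 := row (d + 1 + 1 + 1) (d + 1) (by omega) (by omega)
  rw [Finset.sum_range_succ, if_neg (by omega)] at r1
  rw [if_neg (by omega)] at r2
  rw [show 2 * (d + 1) + 1 - d = d + 1 + 1 + 1 by omega] at hk
  push_cast at *
  linarith

/-- Lower bound for the driving-point response at the exceptional value, `k` odd. -/
theorem le_twin_response_odd {d : ℕ} (hd : 2 ≤ d) {Y : ℕ → ℝ}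
    (hY : ∀ i < 2 * d + 1, antiregularOp (2 * d + 1) (d + 1 : ℕ) Y i = if i = d then 1 else 0) :
    -(1 / 2) + 1 / (2 * (d : ℝ) * (d + 1)) ≤ Y d := by
  have hd' : (0 : ℝ) < d := by exact_mod_cast (by omega : 0 < d)
  have row : ∀ i m, i + m = 2 * d + 1 → 0 < m → ((d : ℝ) - i) * Y i
      = (∑ j ∈ Finset.range m, Y j) + if i = d then 1 else 0 := by
    intro i m him hm
    have h := hY i (by omega)
    rw [antiregularOp, show 2 * d + 1 - i = m by omega] at h
    push_cast at h
    linarith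
  have hsum := sum_antiregularOp (2 * d + 1) (d + 1 : ℕ) Y
  rw [Finset.sum_congr rfl fun i hi => hY i (Finset.mem_range.1 hi)] at hsum
  simp only [Finset.sum_ite_eq', Finset.mem_range, show d < 2 * d + 1 by omega, if_true] at hsum
  push_cast at hsum
  have h0 := row 0 (2 * d + 1) (by omega) (by omega)
  rw [if_neg (by omega)] at h0
  have hY0 : Y 0 = -(1 / ((d : ℝ) * (d + 1))) := by
    field_simp
    push_cast at h0
    nlinarith
  -- The same inward induction, with mirror index `2 * d - i`.
  have key : ∀ i < d, Y i ≤ 0 ∧ 1 / ((d : ℝ) * (d + 1)) ≤ (d - i) * Y (2 * d - i) := by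
    intro i
    induction i with
    | zero =>
      intro _
      have hlast := row (2 * d) 1 (by omega) (by omega)
      rw [if_neg (by omega), Finset.sum_range_one, add_zero] at hlast
      push_cast at hlast
      refine ⟨by rw [hY0]; exact neg_nonpos.2 (by positivity), ?_⟩
      rw [Nat.sub_zero]
      push_cast
      linarith
    | succ i ih =>
      intro hi
      obtain ⟨hp, hq⟩ := ih (by omega)
      have hid : ((i + 1 : ℕ) : ℝ) < d := by exact_mod_cast hi
      push_cast at hid
      have hqpos : 0 ≤ Y (2 * d - i) := by
        have : 0 ≤ (d - i) * Y (2 * d - i) := le_trans (by positivity) hq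
        exact nonneg_of_mul_nonneg_right this (by linarith)
      have r1 := row i (2 * d - i + 1) (by omega) (by omega)
      have r2 := row (i + 1) (2 * d - i) (by omega) (by omega)
      rw [Finset.sum_range_succ, if_neg (by omega)] at r1
      rw [if_neg (by omega)] at r2
      have hp' : Y (i + 1) ≤ 0 := by
        have h1 : ((d : ℝ) - 1 - i) * Y (i + 1) = (d - i) * Y i - Y (2 * d - i) := by
          push_cast at r2; linarith
        have h2 : ((d : ℝ) - i) * Y i ≤ 0 :=
          mul_nonpos_of_nonneg_of_nonpos (by linarith) hp
        exact nonpos_of_mul_nonpos_right (by linarith : ((d : ℝ) - 1 - i) * Y (i + 1) ≤ 0)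
          (by linarith)
      refine ⟨hp', ?_⟩
      have r3 := row (2 * d - i) (i + 1) (by omega) (by omega)
      have r4 := row (2 * d - (i + 1)) (i + 1 + 1) (by omega) (by omega)
      rw [if_neg (by omega), Nat.cast_sub (by omega)] at r3
      rw [Finset.sum_range_succ, if_neg (by omega), Nat.cast_sub (by omega)] at r4
      push_cast at r3 r4 ⊢
      linarith
  obtain ⟨d, rfl⟩ : ∃ c, d = c + 2 := ⟨d - 2, by omega⟩
  have hk := (key d (by omega)).2
  -- Here the diagonal coefficient vanishes at the twin itself. With `c = d + 2` the index of the
  -- twin, the four rows around it give `Y c = Y (c - 1)` and `2 * Y c = -1 + 2 * Y (c + 2)`; the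
  -- inductive bound then applies to `2 * Y (c + 2)`.
  have r0 := row (d + 2) (d + 3) (by omega) (by omega)
  have r1 := row (d + 3) (d + 2) (by omega) (by omega)
  have r2 := row (d + 1) (d + 4) (by omega) (by omega)
  rw [if_pos rfl, Finset.sum_range_succ] at r0
  rw [if_neg (by omega)] at r1
  rw [Finset.sum_range_succ, Finset.sum_range_succ, Finset.sum_range_succ,
    if_neg (by omega)] at r2
  rw [show 2 * (d + 2) - d = d + 4 by omega] at hk
  have r4 := row (d + 4) (d + 1) (by omega) (by omega)
  rw [if_neg (by omega)] at r4
  rw [Finset.sum_range_succ] at r1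
  have hE : 1 / (2 * (((d + 2 : ℕ) : ℝ)) * ((d + 2 : ℕ) + 1))
      = (1 / (((d + 2 : ℕ) : ℝ) * ((d + 2 : ℕ) + 1))) / 2 := by
    field_simp
  rw [hE]
  generalize 1 / (((d + 2 : ℕ) : ℝ) * ((d + 2 : ℕ) + 1)) = E at *
  rw [Finset.sum_range_succ] at r0
  push_cast at *
  linarith

end AntiregularResponse

/-! ### Propagation of flows and impedances along the chain. -/

section Chain

theorem LinkEnd.pos_lt {k : ℕ} (hk : 0 < k) (e : LinkEnd) : e.pos k < k := by
  cases e <;> simp only [LinkEnd.pos] <;> omega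

/-- Quantitative comparison of the responses at the exceptional value `⌈k / 2⌉`. -/
theorem exists_response_bounds {k : ℕ} (hk : 4 ≤ k) : ∃ z E : ℝ, 0 ≤ E ∧
    (∀ e : LinkEnd, 0 < z + endResponse k ((k + 1) / 2 : ℕ) e (e.pos k) ∧
      endResponse k ((k + 1) / 2 : ℕ) e ((k + 1) / 2 - 1) ^ 2
        ≤ (z + endResponse k ((k + 1) / 2 : ℕ) e (e.pos k)) * E) ∧
    ∀ Y : ℕ → ℝ, (∀ i < k, antiregularOp k ((k + 1) / 2 : ℕ) Y i
      = if i = (k + 1) / 2 - 1 then 1 else 0) → z + E ≤ 1 + Y ((k + 1) / 2 - 1) := by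
  rcases Nat.even_or_odd' k with ⟨c, rfl | rfl⟩
  · obtain ⟨d, rfl⟩ : ∃ d, c = d + 2 := ⟨c - 2, by omega⟩
    have e1 : (2 * (d + 2) + 1) / 2 = d + 2 := by omega
    have hd : (0 : ℝ) ≤ d := Nat.cast_nonneg d
    rw [e1]
    -- `z + E` is exactly one plus the even lower bound for the twin response. It remains to check
    -- that coupling to the next copy costs at most `E`.
    refine ⟨1, 1 / ((d : ℝ) + 2) ^ 2, by positivity, fun e => ?_, fun Y hY => ?_⟩
    · cases e with
      | dominating =>
        have ha : endResponse (2 * (d + 2)) (d + 2 : ℕ) .dominating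
            (LinkEnd.dominating.pos (2 * (d + 2))) = ((d : ℝ) + 1) / (d + 2) ^ 2 := by
          simp only [endResponse, LinkEnd.pos, if_true]
          push_cast
          congr 1 <;> ring
        have hb : endResponse (2 * (d + 2)) (d + 2 : ℕ) .dominating (d + 2 - 1)
            = -1 / ((d : ℝ) + 2) ^ 2 := by
          simp only [endResponse, show d + 2 - 1 ≠ 0 by omega, if_false]
          push_cast
          congr 1
          ring
        rw [ha, hb]
        refine ⟨by positivity, ?_⟩
        rw [div_pow, neg_one_sq, ← pow_mul, mul_one_div, le_div_iff₀ (by positivity)]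
        have h1 : 1 / ((d : ℝ) + 2) ^ (2 * 2) * (d + 2) ^ 2 ≤ 1 := by
          rw [div_mul_eq_mul_div, div_le_one (by positivity), one_mul]
          exact pow_le_pow_right₀ (by linarith) (by norm_num)
        have h2 : 0 ≤ ((d : ℝ) + 1) / (d + 2) ^ 2 := by positivity
        linarith
      | terminal =>
        have ha : endResponse (2 * (d + 2)) (d + 2 : ℕ) .terminal
            (LinkEnd.terminal.pos (2 * (d + 2))) = -((d : ℝ) + 3) / (d + 2) ^ 2 := by
          simp only [endResponse, LinkEnd.pos, if_true, show 2 * (d + 2) - 1 ≠ 0 by omega, if_false]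
          push_cast
          rw [show 2 * ((d : ℝ) + 2) - (d + 2) = d + 2 by ring,
            show 1 - ((d : ℝ) + 2) = -(d + 1) by ring]
          field_simp
          ring
        have hb : endResponse (2 * (d + 2)) (d + 2 : ℕ) .terminal (d + 2 - 1)
            = 1 / ((d + 2) ^ 2 * ((d : ℝ) + 1)) := by
          simp only [endResponse, show d + 2 - 1 ≠ 0 by omega, if_false,
            show d + 2 - 1 ≠ 2 * (d + 2) - 1 by omega]
          push_cast
          rw [show 2 * ((d : ℝ) + 2) - (d + 2) = d + 2 by ring,
            show 1 - ((d : ℝ) + 2) = -(d + 1) by ring]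
          field_simp
        rw [ha, hb]
        have h1 : 1 + -((d : ℝ) + 3) / (d + 2) ^ 2 = (d ^ 2 + 3 * d + 1) / (d + 2) ^ 2 := by
          field_simp; ring
        rw [h1]
        refine ⟨by positivity, ?_⟩
        rw [div_pow, one_pow, mul_one_div, div_div, div_le_div_iff₀ (by positivity) (by positivity)]
        have h2 : (1 : ℝ) ≤ (d + 1) ^ 2 := one_le_pow₀ (by linarith)
        have h3 : (1 : ℝ) ≤ d ^ 2 + 3 * d + 1 := by nlinarith
        have h4 : (1 : ℝ) ≤ (d ^ 2 + 3 * d + 1) * (d + 1) ^ 2 := one_le_mul_of_one_le_of_one_le h3 h2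
        have h5 : (0 : ℝ) ≤ (d + 2) ^ 2 * (d + 2) ^ 2 := by positivity
        nlinarith [mul_le_mul_of_nonneg_left h4 h5]
    · have := le_twin_response_even (d := d + 1) (by omega) (Y := Y) (fun i hi => hY i (by omega))
      push_cast at this
      rw [show d + 2 - 1 = d + 1 by omega, show (d : ℝ) + 2 = d + 1 + 1 by ring]
      linarith
  · obtain ⟨d, rfl⟩ : ∃ d, c = d + 2 := ⟨c - 2, by omega⟩
    have e1 : (2 * (d + 2) + 1 + 1) / 2 = d + 3 := by omega
    have hd : (0 : ℝ) ≤ d := Nat.cast_nonneg d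
    rw [e1]
    -- Again `z + E` is one plus the lower bound, now the odd one, whose leading part is `-1/2`.
    refine ⟨1 / 2, 1 / (2 * ((d : ℝ) + 2) * (d + 3)), by positivity, fun e => ?_, fun Y hY => ?_⟩
    · cases e with
      | dominating =>
        have ha : endResponse (2 * (d + 2) + 1) (d + 3 : ℕ) .dominating
            (LinkEnd.dominating.pos (2 * (d + 2) + 1)) = 1 / ((d : ℝ) + 3) := by
          simp only [endResponse, LinkEnd.pos, if_true]
          push_cast
          rw [show 2 * ((d : ℝ) + 2) + 1 - (d + 3) = d + 2 by ring]
          field_simp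
          ring
        have hb : endResponse (2 * (d + 2) + 1) (d + 3 : ℕ) .dominating (d + 3 - 1)
            = -1 / (((d : ℝ) + 3) * (d + 2)) := by
          simp only [endResponse, show d + 3 - 1 ≠ 0 by omega, if_false]
          push_cast
          congr 1
          ring
        rw [ha, hb]
        refine ⟨by positivity, ?_⟩
        have h1 : 1 / 2 + 1 / ((d : ℝ) + 3) = (d + 5) / (2 * (d + 3)) := by
          field_simp; ring
        rw [h1, div_pow, neg_one_sq, mul_one_div, div_div,
          div_le_div_iff₀ (by positivity) (by positivity)]
        have h2 : (4 : ℝ) ≤ (d + 5) * (d + 2) := by nlinarith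
        have h5 : (0 : ℝ) ≤ (d + 3) ^ 2 * (d + 2) := by positivity
        nlinarith [mul_le_mul_of_nonneg_left h2 h5]
      | terminal =>
        have ha : endResponse (2 * (d + 2) + 1) (d + 3 : ℕ) .terminal
            (LinkEnd.terminal.pos (2 * (d + 2) + 1))
            = -((d : ℝ) ^ 2 + 5 * d + 5) / ((d + 2) ^ 2 * (d + 3)) := by
          simp only [endResponse, LinkEnd.pos, if_true, show 2 * (d + 2) + 1 - 1 ≠ 0 by omega,
            if_false]
          push_cast
          rw [show 2 * ((d : ℝ) + 2) + 1 - (d + 3) = d + 2 by ring,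
            show 1 - ((d : ℝ) + 3) = -(d + 2) by ring]
          field_simp
          ring
        have hb : endResponse (2 * (d + 2) + 1) (d + 3 : ℕ) .terminal (d + 3 - 1)
            = 1 / ((d + 2) ^ 2 * ((d : ℝ) + 3)) := by
          simp only [endResponse, show d + 3 - 1 ≠ 0 by omega, if_false,
            show d + 3 - 1 ≠ 2 * (d + 2) + 1 - 1 by omega]
          push_cast
          rw [show 2 * ((d : ℝ) + 2) + 1 - (d + 3) = d + 2 by ring,
            show 1 - ((d : ℝ) + 3) = -(d + 2) by ring]
          field_simp
        rw [ha, hb]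
        have h1 : 1 / 2 + -((d : ℝ) ^ 2 + 5 * d + 5) / ((d + 2) ^ 2 * (d + 3))
            = (d + 1) * (d ^ 2 + 4 * d + 2) / (2 * (d + 2) ^ 2 * (d + 3)) := by
          field_simp; ring
        rw [h1]
        refine ⟨by positivity, ?_⟩
        rw [div_pow, one_pow, mul_one_div, div_div, div_le_div_iff₀ (by positivity) (by positivity)]
        have h2 : (4 : ℝ) ≤ (d + 2) * ((d + 1) * (d ^ 2 + 4 * d + 2)) := by
          have : (2 : ℝ) ≤ (d + 1) * (d ^ 2 + 4 * d + 2) := by nlinarith [pow_nonneg hd 3]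
          nlinarith
        have h5 : (0 : ℝ) ≤ (d + 2) ^ 3 * (d + 3) ^ 2 := by positivity
        nlinarith [mul_le_mul_of_nonneg_left h2 h5]
    · have := le_twin_response_odd (d := d + 2) (by omega) (Y := Y) (fun i hi => hY i (by omega))
      push_cast at this
      rw [show d + 3 - 1 = d + 2 by omega, show (d : ℝ) + 3 = d + 2 + 1 by ring]
      linarith

/-- The impedances which can be seen at the exceptional value by a chain of copies. -/
theorem exists_impedance_set {k : ℕ} (hk : 3 ≤ k)
    (hreg : AntiregularRegularValue k ((k + 1) / 2 : ℕ)) : ∃ S : Set ℝ,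
    (∀ (e : LinkEnd) (f h z : ℝ) (Y : ℕ → ℝ),
      (∀ i < k, antiregularOp k ((k + 1) / 2 : ℕ) Y i
        = (if i = (k + 1) / 2 - 1 then f else 0) - if i = e.pos k then h else 0) →
      f ≠ 0 → (h = 0 ∨ z ∈ S ∧ Y (e.pos k) = z * h) →
      ∃ z' ∈ S, f + Y ((k + 1) / 2 - 1) = z' * f) ∧
    ∀ (e : LinkEnd) (h z : ℝ) (Y : ℕ → ℝ), (e = .terminal → 4 ≤ k) →
      (∀ i < k, antiregularOp k ((k + 1) / 2 : ℕ) Y i = -(if i = e.pos k then h else 0)) →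
      z ∈ S → Y (e.pos k) = z * h → h = 0 := by
  rcases Nat.lt_or_ge 3 k with hk4 | hk3
  · obtain ⟨z₀, E, hE, hw, hG⟩ := exists_response_bounds hk4
    set κ := (k + 1) / 2 with hκ
    -- A half-line suffices: an impedance in it stays in it through each copy, and `z + w (e.pos k)
    -- > 0` excludes resonance.
    refine ⟨Set.Ici z₀, ?_, ?_⟩
    · intro e f h z Y hY hf hz
      obtain ⟨hw1, hw2⟩ := hw e
      set w := endResponse k κ e with hwdef
      have hop : ∀ i < k, antiregularOp k κ w i = if i = e.pos k then 1 else 0 := fun i hi =>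
        antiregularOp_endResponse hk (hreg.ne_zero (by omega)) (hreg.ne_one hk)
          (hreg.ne_natCast (by omega)) e hi
      have hZ : ∀ i < k, antiregularOp k κ (fun i => Y i - -h * w i) i
          = if i = κ - 1 then f else 0 := by
        intro i hi
        rw [antiregularOp_sub_smul, hY i hi, hop i hi]
        split_ifs <;> ring
      have hp := apply_pos_eq_of_antiregularOp_eq hreg hk e hZ
      rw [← hκ, ← hwdef] at hp
      have hg := hG (fun i => f⁻¹ * (Y i - -h * w i)) (fun i hi => by
        rw [antiregularOp_smul, hZ i hi]
        split_ifs
        · exact inv_mul_cancel₀ hf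
        · exact mul_zero _)
      set G := f⁻¹ * (Y (κ - 1) - -h * w (κ - 1)) with hGdef
      have hGf : Y (κ - 1) = G * f - h * w (κ - 1) := by
        rw [hGdef]; field_simp; ring
      rcases hz with rfl | ⟨hz, hYp⟩
      · refine ⟨1 + G, Set.mem_Ici.2 (by linarith), ?_⟩
        rw [hGf]; ring
      · rw [Set.mem_Ici] at hz
        have hzw : 0 < z + w (e.pos k) := by linarith
        have hh : h = f * w (κ - 1) / (z + w (e.pos k)) := by
          rw [eq_div_iff hzw.ne']
          linarith
        -- Eliminating `h` gives the new impedance: 1 for the link, plus the driving-point response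
        -- `G` at the twin, minus the load of the following copy; reciprocity makes the transfer
        -- factor a square.
        refine ⟨1 + G - w (κ - 1) ^ 2 / (z + w (e.pos k)), Set.mem_Ici.2 ?_, ?_⟩
        · have : w (κ - 1) ^ 2 / (z + w (e.pos k)) ≤ E := by
            rw [div_le_iff₀ hzw, mul_comm]
            exact hw2.trans (mul_le_mul_of_nonneg_right (by linarith) hE)
          linarith
        · rw [hGf, hh]; ring
    · intro e h z Y _ hY hz hYp
      rw [hreg.eq_smul_endResponse hk hY _ (e.pos_lt (by omega))] at hYp
      have h1 := (hw e).1
      rw [Set.mem_Ici] at hz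
      have h2 : (z + endResponse k κ e (e.pos k)) * h = 0 := by linarith
      exact (mul_eq_zero.1 h2).resolve_left (by linarith)
  · obtain rfl : k = 3 := by omega
    -- For `k = 3` a copy acts on impedances by `z / (1 + 2 * z)` or `(z - 1) / (2 * z - 1)`, and
    -- the last copy presents `1 / 2`. The second map exchanges the two pieces apart from its pole
    -- `1 / 2`, where `f = 0`. A terminal link of the first copy would resonate at `z = 1 / 2`,
    -- hence the demand `4 ≤ k`.
    refine ⟨{z | 0 < z ∧ z ≤ 1 / 2 ∨ 1 < z}, ?_, ?_⟩
    · intro e f h z Y hY hf hz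
      have r0 := hY 0 (by norm_num)
      have r1 := hY 1 (by norm_num)
      have r2 := hY 2 (by norm_num)
      cases e with
      | dominating =>
        simp [antiregularOp, LinkEnd.pos, Finset.sum_range_succ] at r0 r1 r2 hz ⊢
        have hY0 : Y 0 = -(f + h) / 2 := by linarith
        have hY1 : Y 1 = (h - f) / 2 := by linarith
        rw [hY1]
        rcases hz with rfl | ⟨hz, hz'⟩
        · exact ⟨1 / 2, by norm_num, by ring⟩
        · have hz0 : 0 < z := by rcases hz with h | h <;> linarith
          refine ⟨z / (1 + 2 * z), Or.inl ⟨by positivity, ?_⟩, ?_⟩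
          · rw [div_le_iff₀ (by positivity)]; linarith
          · have : f = -(1 + 2 * z) * h := by linarith
            rw [this]
            field_simp
            ring
      | terminal =>
        simp [antiregularOp, LinkEnd.pos, Finset.sum_range_succ] at r0 r1 r2 hz ⊢
        have hY2 : Y 2 = (f + h) / 2 := by linarith
        have hY1 : Y 1 = -(f + h) / 2 := by linarith
        rw [hY1]
        rcases hz with rfl | ⟨hz, hz'⟩
        · exact ⟨1 / 2, by norm_num, by ring⟩
        · have hfh : f = (2 * z - 1) * h := by linarith
          have hz1 : 2 * z - 1 ≠ 0 := by
            intro h0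
            rw [h0, zero_mul] at hfh
            exact hf hfh
          refine ⟨(z - 1) / (2 * z - 1), ?_, ?_⟩
          · rcases hz with ⟨h1, h2⟩ | h1
            · have h3 : z < 1 / 2 := lt_of_le_of_ne (by linarith) fun h => hz1 (by rw [h]; norm_num)
              right
              rw [lt_div_iff_of_neg (by linarith)]
              linarith
            · left
              exact ⟨div_pos (by linarith) (by linarith), by
                rw [div_le_iff₀ (by linarith)]; linarith⟩
          · rw [hfh]
            field_simp
            ring
    · intro e h z Y he hY hz hYp
      cases e with
      | dominating =>
        have r0 := hY 0 (by norm_num)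
        have r1 := hY 1 (by norm_num)
        have r2 := hY 2 (by norm_num)
        simp [antiregularOp, LinkEnd.pos, Finset.sum_range_succ] at r0 r1 r2 hYp
        have hz0 : 0 < z := by rcases hz with h | h <;> linarith [h]
        have : (1 + 2 * z) * h = 0 := by linarith
        exact (mul_eq_zero.1 this).resolve_left (by positivity)
      | terminal => exact absurd (he rfl) (by norm_num)

/-- An eigenvector of a chain of antiregular graphs is not orthogonal to the input vector. -/
theorem chain_eq_zero {n k : ℕ} (hn : 1 ≤ n) (hk : 3 ≤ k) {s : ℕ → LinkEnd} {b : ℕ → ℝ}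
    (hb : ∀ i < k, b i = 0 ∨ b i = 1) (hb1 : b ((k + 1) / 2 - 1) + b ((k + 1) / 2) = 1)
    (hs : s 0 = .terminal → 4 ≤ k ∧ b (k - 1) = 0) {μ : ℝ} {X : ℕ → ℕ → ℝ} {F : ℕ → ℝ}
    (hF0 : F 0 = 0) (hFn : F n = 0)
    (hF : ∀ a, a + 1 < n → F (a + 1) = X a ((s a).pos k) - X (a + 1) ((k + 1) / 2 - 1))
    (hX : ∀ a < n, ∀ i < k, antiregularOp k μ (X a) i
      = (if i = (k + 1) / 2 - 1 then F a else 0) - if i = (s a).pos k then F (a + 1) else 0)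
    (hbX : ∑ i ∈ Finset.range k, b i * X 0 i = 0) :
    ∀ a < n, ∀ i < k, X a i = 0 := by
  have hq : (k + 1) / 2 - 1 < k := by omega
  have hpos : ∀ a, (s a).pos k < k := fun a => (s a).pos_lt (by omega)
  by_cases hreg : AntiregularRegularValue k μ
  · suffices h1 : F 1 = 0 by
      -- Forward induction: if copy `a` and its outgoing flow vanish, the next copy is an end
      -- response vanishing at its twin, hence zero.
      have key : ∀ a < n, F (a + 1) = 0 ∧ ∀ i < k, X a i = 0 := by
        intro a
        induction a with
        | zero =>
          intro ha
          refine ⟨h1, hreg _ fun i hi => ?_⟩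
          rw [hX 0 ha i hi, hF0, h1]
          simp
        | succ a ih =>
          intro ha
          obtain ⟨hFa, hXa⟩ := ih (by omega)
          have hXX : ∀ i < k, antiregularOp k μ (X (a + 1)) i
              = -(if i = (s (a + 1)).pos k then F (a + 1 + 1) else 0) := by
            intro i hi
            rw [hX (a + 1) ha i hi, hFa]
            simp
          have h0 : X (a + 1) ((k + 1) / 2 - 1) = 0 := by
            have := hF a ha
            rw [hFa, hXa _ (hpos a)] at this
            linarith
          have hFa' := hreg.eq_zero_of_twin hk hXX h0
          refine ⟨hFa', hreg _ fun i hi => ?_⟩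
          rw [hXX i hi, hFa']
          simp
      exact fun a ha => (key a ha).2
    have hX0 : ∀ i < k, antiregularOp k μ (X 0) i
        = -(if i = (s 0).pos k then F 1 else 0) := by
      intro i hi
      rw [hX 0 (by omega) i hi, hF0]
      simp
    rcases hreg.eq_zero_or_eq_of_sum_eq_zero hk hb hb1 (fun h => (hs h).2) hX0 hbX with h | rfl
    · exact h
    obtain ⟨S, hS1, hS2⟩ := exists_impedance_set hk hreg
    -- Backward induction from the free end. By the link equation `F a + X a twin` is the potential
    -- at the end vertex of copy `a - 1`, so `z` is the impedance seen from there.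
    have back : ∀ m a, a + m + 1 = n → F a = 0 ∨ ∃ z ∈ S,
        F a + X a ((k + 1) / 2 - 1) = z * F a := by
      intro m
      induction m with
      | zero =>
        intro a ha
        refine or_iff_not_imp_left.2 fun hFa => hS1 (s a) _ _ 0 _ (hX a (by omega)) hFa
          (Or.inl ?_)
        rwa [show a + 1 = n by omega]
      | succ m ih =>
        intro a ha
        refine or_iff_not_imp_left.2 fun hFa => ?_
        rcases ih (a + 1) (by omega) with h | ⟨z, hz, hzF⟩
        · exact hS1 (s a) _ _ 0 _ (hX a (by omega)) hFa (Or.inl h)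
        · refine hS1 (s a) _ _ z _ (hX a (by omega)) hFa (Or.inr ⟨hz, ?_⟩)
          rw [← hzF, hF a (by omega)]
          ring
    rcases Nat.lt_or_ge 1 n with hn1 | hn1
    · rcases back (n - 2) 1 (by omega) with h | ⟨z, hz, hzF⟩
      · exact h
      · refine hS2 (s 0) _ z _ (fun h => (hs h).1) hX0 hz ?_
        rw [← hzF, hF 0 (by omega)]
        ring
    · rwa [show n = 1 by omega] at hFn
  · rw [AntiregularRegularValue] at hreg
    push Not at hreg
    obtain ⟨v, hv, j, hj, hvj⟩ := hreg
    have hvk : v ((k + 1) / 2 - 1) ≠ 0 := fun h =>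
      hvj (eq_zero_of_antiregularOp_eq_zero_of_twin (by omega) hv h j hj)
    -- Fredholm alternative: an excitation at the twin alone must be orthogonal to the eigenvector
    -- `v`, which is nonzero there.
    have pair : ∀ a < n, F (a + 1) = 0 → F a = 0 := by
      intro a ha hFa
      have hsym := antiregularOp_symm k μ (X a) v
      rw [Finset.sum_congr rfl fun i hi => congrArg (v i * ·) (hX a ha i (Finset.mem_range.1 hi)),
        Finset.sum_congr rfl fun i hi => congrArg (X a i * ·) (hv i (Finset.mem_range.1 hi))] at hsym
      simp only [hFa, ite_self, sub_zero, mul_ite, mul_zero, Finset.sum_ite_eq', Finset.mem_range,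
        hq, if_true, Finset.sum_const_zero] at hsym
      exact (mul_eq_zero.1 hsym).resolve_left hvk
    have hFz : ∀ m a, a + m = n → F a = 0 := by
      intro m
      induction m with
      | zero => intro a ha; rwa [show a = n by omega]
      | succ m ih => exact fun a ha => pair a (by omega) (ih (a + 1) (by omega))
    have hX' : ∀ a < n, ∀ i < k, antiregularOp k μ (X a) i = 0 := by
      intro a ha i hi
      rw [hX a ha i hi, hFz (n - a) a (by omega), hFz (n - a - 1) (a + 1) (by omega)]
      simp
    intro a
    induction a with
    | zero =>
      exact fun ha => eq_zero_of_antiregularOp_eq_zero_of_sum_eq_zero (by omega) hb hb1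
        (hX' 0 ha) hbX
    | succ a ih =>
      intro ha
      refine eq_zero_of_antiregularOp_eq_zero_of_twin (by omega) (hX' (a + 1) ha) ?_
      have := hF a ha
      rw [hFz (n - a - 1) (a + 1) (by omega), ih (by omega) _ (hpos a)] at this
      linarith

end Chain

/-! ### From graph Laplacians to the sequence operators, and the two criteria. -/

section Laplacian

open Matrix

theorem lapMatrix_mulVec_eq_sum {V : Type*} [Fintype V] [DecidableEq V] (G : SimpleGraph V)
    [DecidableRel G.Adj] (x : V → ℝ) (v : V) :
    (G.lapMatrix ℝ *ᵥ x) v = ∑ w, if G.Adj v w then x v - x w else 0 := by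
  rw [SimpleGraph.lapMatrix_mulVec_apply, ← Finset.sum_filter, Finset.sum_sub_distrib,
    Finset.sum_const, nsmul_eq_mul, ← SimpleGraph.neighborFinset_eq_filter,
    SimpleGraph.card_neighborFinset_eq_degree]

/-- The neighbours of `i` are the `j < k - i` other than `i`; including `j = i` is harmless, since
that term is `Y i - Y i`. -/
theorem sum_antiregularGraph_adj {k : ℕ} (Y : ℕ → ℝ) (i : Fin k) :
    (∑ j : Fin k, if (antiregularGraph k).Adj i j then Y i - Y j else 0)
      = antiregularOp k 0 Y i := by
  have h1 : ∀ j : Fin k, (if (antiregularGraph k).Adj i j then Y i - Y j else 0)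
      = (fun j : ℕ => if j < k - i then Y i - Y j else 0) j := by
    intro j
    have hadj : (antiregularGraph k).Adj i j ↔ i ≠ j ∧ ((i : ℕ) + 1) + ((j : ℕ) + 1) ≤ k + 1 :=
      Iff.rfl
    rcases eq_or_ne i j with rfl | hij
    · simp
    · simp only [hadj, hij, ne_eq, not_false_iff, true_and]
      congr 1
      exact propext (by omega)
  rw [Finset.sum_congr rfl fun j _ => h1 j,
    Fin.sum_univ_eq_sum_range (fun j : ℕ => if j < k - i then Y i - Y j else 0) k,
    ← Finset.sum_filter, show (Finset.range k).filter (fun j => j < k - i) = Finset.range (k - i) by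
      ext j; simp only [Finset.mem_filter, Finset.mem_range]; omega,
    Finset.sum_sub_distrib, antiregularOp, Finset.sum_const, Finset.card_range, nsmul_eq_mul,
    Nat.cast_sub i.2.le, sub_zero]

theorem antiregularGraph_lapMatrix_mulVec {k : ℕ} (Y : ℕ → ℝ) (i : Fin k) :
    ((antiregularGraph k).lapMatrix ℝ *ᵥ fun j : Fin k => Y j) i = antiregularOp k 0 Y i := by
  rw [lapMatrix_mulVec_eq_sum, sum_antiregularGraph_adj]

theorem antiregularOp_eq_sub (k : ℕ) (μ : ℝ) (Y : ℕ → ℝ) (i : ℕ) :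
    antiregularOp k μ Y i = antiregularOp k 0 Y i - μ * Y i := by
  simp only [antiregularOp]
  ring

/-- The flow into copy `a` of the interconnection through the link from the previous copy. -/
def linkFlow (n k : ℕ) (s : ℕ → LinkEnd) (X : ℕ → ℕ → ℝ) : ℕ → ℝ
  | 0 => 0
  | a + 1 => if a + 1 < n then X a ((s a).pos k) - X (a + 1) ((k + 1) / 2 - 1) else 0

/-- The Laplacian splits into the edges inside a copy, the outgoing link and the incoming link. The
zero values of `linkFlow` at 0 and from `n` on account for the missing links at the two ends of the
chain. -/
theorem interconnectedGraph_lapMatrix_mulVec {n k : ℕ} (hk : 0 < k) (s : ℕ → LinkEnd)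
    (X : ℕ → ℕ → ℝ) (v : Fin n × Fin k) :
    ((interconnectedGraph n k s).lapMatrix ℝ *ᵥ fun w : Fin n × Fin k => X w.1 w.2) v
      = antiregularOp k 0 (X v.1) v.2
        - ((if (v.2 : ℕ) = (k + 1) / 2 - 1 then linkFlow n k s X v.1 else 0)
          - if (v.2 : ℕ) = (s v.1).pos k then linkFlow n k s X (v.1 + 1) else 0) := by
  obtain ⟨a, i⟩ := v
  have hsplit : ∀ w : Fin n × Fin k,
      (if (interconnectedGraph n k s).Adj (a, i) w then X a i - X w.1 w.2 else 0)
        = (if a = w.1 then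
            (if (antiregularGraph k).Adj i w.2 then X a i - X a w.2 else 0) else 0)
          + (if IsLink n k s (a, i) w then X a i - X w.1 w.2 else 0)
          + (if IsLink n k s w (a, i) then X a i - X w.1 w.2 else 0) := by
    intro w
    have hadj : (interconnectedGraph n k s).Adj (a, i) w ↔
        (a = w.1 ∧ (antiregularGraph k).Adj i w.2) ∨
          IsLink n k s (a, i) w ∨ IsLink n k s w (a, i) := Iff.rfl
    by_cases h1 : a = w.1
    · have h2 : ¬ IsLink n k s (a, i) w := fun h => by
        have := h.1; rw [← h1] at this; simp at this
      have h3 : ¬ IsLink n k s w (a, i) := fun h => by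
        have := h.1; rw [← h1] at this; simp at this
      simp only [hadj, h2, h3, or_false, if_false, add_zero, ← h1, true_and, if_true]
    · by_cases h2 : IsLink n k s (a, i) w
      · have h3 : ¬ IsLink n k s w (a, i) := fun h => by
          have h4 := h.1
          have h5 := h2.1
          simp only at h4 h5
          omega
        simp [hadj, h1, h2, h3]
      · simp [hadj, h1, h2]
  have hin : (∑ w : Fin n × Fin k, if a = w.1 then
      (if (antiregularGraph k).Adj i w.2 then X a i - X a w.2 else 0) else 0)
        = antiregularOp k 0 (X a) i := by
    rw [Fintype.sum_prod_type, Fintype.sum_eq_single a]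
    · simp only [if_true]
      exact sum_antiregularGraph_adj (X a) i
    · intro a' ha'
      simp [ha'.symm]
  have hout : (∑ w : Fin n × Fin k, if IsLink n k s (a, i) w then X a i - X w.1 w.2 else 0)
      = if (i : ℕ) = (s a).pos k then linkFlow n k s X (a + 1) else 0 := by
    by_cases hi : (i : ℕ) = (s a).pos k
    · by_cases ha : (a : ℕ) + 1 < n
      · rw [Fintype.sum_eq_single ((⟨a + 1, ha⟩, ⟨(k + 1) / 2 - 1, by omega⟩) : Fin n × Fin k)]
        · rw [if_pos ⟨rfl, hi, rfl⟩, if_pos hi, linkFlow, if_pos ha, hi]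
        · rintro w hw
          rw [if_neg]
          rintro ⟨h1, -, h3⟩
          exact hw (Prod.ext (Fin.ext h1) (Fin.ext h3))
      · rw [if_pos hi, linkFlow, if_neg ha]
        refine Finset.sum_eq_zero fun w _ => if_neg fun h => ha ?_
        rw [← h.1]
        exact w.1.2
    · rw [if_neg hi]
      exact Finset.sum_eq_zero fun w _ => if_neg fun h => hi h.2.1
  have hback : (∑ w : Fin n × Fin k, if IsLink n k s w (a, i) then X a i - X w.1 w.2 else 0)
      = -(if (i : ℕ) = (k + 1) / 2 - 1 then linkFlow n k s X a else 0) := by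
    by_cases hi : (i : ℕ) = (k + 1) / 2 - 1
    · rw [if_pos hi]
      obtain ⟨a, ha⟩ := a
      cases a with
      | zero =>
        rw [linkFlow, neg_zero]
        exact Finset.sum_eq_zero fun w _ => if_neg fun h => by simpa using h.1
      | succ a =>
        rw [Fintype.sum_eq_single
          ((⟨a, by omega⟩, ⟨(s a).pos k, (s a).pos_lt hk⟩) : Fin n × Fin k)]
        · rw [if_pos ⟨rfl, rfl, hi⟩, linkFlow, if_pos ha, hi, neg_sub]
        · rintro w hw
          rw [if_neg]
          rintro ⟨h1, h2, -⟩
          have h3 : (w.1 : ℕ) = a := by simpa using h1.symm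
          rw [h3] at h2
          exact hw (Prod.ext (Fin.ext h3) (Fin.ext h2))
    · rw [if_neg hi, neg_zero]
      exact Finset.sum_eq_zero fun w _ => if_neg fun h => hi h.2.2
  rw [lapMatrix_mulVec_eq_sum, Finset.sum_congr rfl fun w _ => hsplit w, Finset.sum_add_distrib,
    Finset.sum_add_distrib, hin, hout, hback]
  ring

/-- Hautus test for Laplacian controllability. -/
theorem laplacianControllable_of_eigenvector {V : Type*} [Fintype V] [DecidableEq V]
    (G : SimpleGraph V) [DecidableRel G.Adj] {b : V → ℝ}
    (h : ∀ (μ : ℝ) (v : V → ℝ), G.lapMatrix ℝ *ᵥ v = μ • v → v ⬝ᵥ b = 0 → v = 0) :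
    LaplacianControllable G b := by
  refine systemControllable_of_eigenvector ?_ fun μ v hv => h (-μ) v ?_
  · rw [Matrix.IsSymm, transpose_neg, (G.isSymm_lapMatrix (R := ℝ)).eq]
  · rw [neg_mulVec] at hv
    rw [neg_smul, ← hv, neg_neg]

theorem not_laplacianControllable_of_eigenvector {V : Type*} [Fintype V] [DecidableEq V]
    (G : SimpleGraph V) [DecidableRel G.Adj] {b v : V → ℝ} {μ : ℝ}
    (hv : G.lapMatrix ℝ *ᵥ v = μ • v) (hb : v ⬝ᵥ b = 0) (hv0 : v ≠ 0) :
    ¬ LaplacianControllable G b := by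
  refine not_systemControllable_of_eigenvector (μ := -μ) ?_ hb hv0
  rw [← mulVec_transpose, transpose_neg, (G.isSymm_lapMatrix (R := ℝ)).eq, neg_mulVec, hv, neg_smul]

/-- The eigenvector of the antiregular graph supported on the two degree-repeating vertices. -/
theorem exists_twin_eigenvector {k : ℕ} (hk : 2 ≤ k) : ∃ (μ : ℝ) (Y : ℕ → ℝ),
    (∀ i < k, antiregularOp k μ Y i = 0) ∧ Y ((k + 1) / 2 - 1) ≠ 0 ∧
      Y ((k + 1) / 2) = -Y ((k + 1) / 2 - 1) ∧
      ∀ i, i ≠ (k + 1) / 2 - 1 → i ≠ (k + 1) / 2 → Y i = 0 := by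
  rcases Nat.even_or_odd' k with ⟨c, rfl | rfl⟩
  · have e1 : (2 * c + 1) / 2 = c := by omega
    have e2 : 2 * c / 2 = c := by omega
    have hc : c - 1 ≠ 2 * c / 2 := by omega
    refine ⟨_, antiregularEigenvector (2 * c) (c - 1),
      fun i hi => antiregularOp_eigenvector (by omega) hc hi, ?_, ?_, ?_⟩ <;> rw [e1]
    · exact antiregularEigenvector_self_ne_zero hc
    · have hcast : ((c - 1 : ℕ) : ℝ) = c - 1 := by rw [Nat.cast_sub (by omega), Nat.cast_one]
      rw [antiregularEigenvector, antiregularEigenvector, hcast]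
      push_cast
      split_ifs <;> first | omega | ring
    · intro i h1 h2
      rw [antiregularEigenvector, e2, if_pos (by omega), if_neg (by omega), if_neg (by omega)]
  · have e1 : (2 * c + 1 + 1) / 2 = c + 1 := by omega
    have e2 : (2 * c + 1) / 2 = c := by omega
    have hc : c + 1 ≠ (2 * c + 1) / 2 := by omega
    refine ⟨_, antiregularEigenvector (2 * c + 1) (c + 1),
      fun i hi => antiregularOp_eigenvector (by omega) hc hi, ?_, ?_, ?_⟩ <;> rw [e1]
    · exact antiregularEigenvector_twin_ne_zero hk hc (by omega) (by omega)
    · rw [antiregularEigenvector, antiregularEigenvector]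
      push_cast
      split_ifs <;> first | omega | ring
    · intro i h1 h2
      rw [antiregularEigenvector, e2, if_neg (by omega), if_neg (by omega), if_neg (by omega)]

theorem sum_mul_eq_zero_of_twin {k : ℕ} (hk : 2 ≤ k) {b Y : ℕ → ℝ}
    (hb : b ((k + 1) / 2) = b ((k + 1) / 2 - 1)) (hY : Y ((k + 1) / 2) = -Y ((k + 1) / 2 - 1))
    (hY0 : ∀ i, i ≠ (k + 1) / 2 - 1 → i ≠ (k + 1) / 2 → Y i = 0) :
    ∑ i ∈ Finset.range k, b i * Y i = 0 := by
  rw [Finset.sum_eq_add_of_mem ((k + 1) / 2 - 1) ((k + 1) / 2)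
    (Finset.mem_range.2 (by omega)) (Finset.mem_range.2 (by omega)) (by omega)
    fun i _ hi => by rw [hY0 i hi.1 hi.2, mul_zero], hb, hY]
  ring

theorem eq_of_add_ne_one {x y : ℝ} (hx : x = 0 ∨ x = 1) (hy : y = 0 ∨ y = 1) (h : x + y ≠ 1) :
    y = x := by
  rcases hx with rfl | rfl <;> rcases hy with rfl | rfl <;> simp at h ⊢

theorem antiregularGraph_laplacianControllable_iff {k : ℕ} (hk : 2 ≤ k) {b : ℕ → ℝ}
    (hb : ∀ i < k, b i = 0 ∨ b i = 1) :
    LaplacianControllable (antiregularGraph k) (fun i => b i) ↔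
      b ((k + 1) / 2 - 1) + b ((k + 1) / 2) = 1 := by
  constructor
  · contrapose
    intro h
    obtain ⟨μ, Y, hop, h0, h1, h2⟩ := exists_twin_eigenvector hk
    refine not_laplacianControllable_of_eigenvector _ (v := fun i => Y i) (μ := μ) ?_ ?_ ?_
    · ext i
      have := hop i i.2
      rw [antiregularOp_eq_sub] at this
      rw [antiregularGraph_lapMatrix_mulVec, Pi.smul_apply, smul_eq_mul]
      linarith
    · rw [dotProduct_comm, dotProduct, Fin.sum_univ_eq_sum_range (fun i => b i * Y i)]
      exact sum_mul_eq_zero_of_twin hk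
        (eq_of_add_ne_one (hb _ (by omega)) (hb _ (by omega)) h) h1 h2
    · exact fun h => h0 (congrFun h ⟨(k + 1) / 2 - 1, by omega⟩)
  · intro h
    refine laplacianControllable_of_eigenvector _ fun μ v hv hvb => ?_
    -- Values from `k` on are arbitrary; the operator on the first `k` rows never reads them.
    obtain ⟨Y, rfl⟩ : ∃ Y : ℕ → ℝ, v = fun i : Fin k => Y i :=
      ⟨fun i => if h : i < k then v ⟨i, h⟩ else 0, by ext i; simp⟩
    have h1 := eq_zero_of_antiregularOp_eq_zero_of_sum_eq_zero hk (μ := μ) (Y := Y) hb h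
      (fun i hi => ?_) ?_
    · ext i
      exact h1 i i.2
    · have := congrFun hv ⟨i, hi⟩
      rw [antiregularGraph_lapMatrix_mulVec, Pi.smul_apply, smul_eq_mul] at this
      rw [antiregularOp_eq_sub, this, sub_self]
    · rwa [dotProduct_comm, dotProduct, Fin.sum_univ_eq_sum_range (fun i => b i * Y i)] at hvb

theorem dotProduct_zeroPad {n k : ℕ} (hn : 1 ≤ n) (b : ℕ → ℝ) (X : ℕ → ℕ → ℝ) :
    (fun v : Fin n × Fin k => X v.1 v.2) ⬝ᵥ zeroPad n (fun i : Fin k => b i)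
      = ∑ i ∈ Finset.range k, b i * X 0 i := by
  rw [dotProduct, Fintype.sum_prod_type, Fintype.sum_eq_single (⟨0, hn⟩ : Fin n)]
  · rw [← Fin.sum_univ_eq_sum_range (fun i => b i * X 0 i)]
    simp [zeroPad, mul_comm]
  · intro a ha
    have : (a : ℕ) ≠ 0 := fun h => ha (Fin.ext h)
    simp [zeroPad, this]

theorem interconnectedGraph_laplacianControllable_iff {n k : ℕ} (hn : 1 ≤ n) (hk : 3 ≤ k)
    {s : ℕ → LinkEnd} {b : ℕ → ℝ} (hb : ∀ i < k, b i = 0 ∨ b i = 1)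
    (hs : s 0 = .terminal → 4 ≤ k ∧ b (k - 1) = 0) :
    LaplacianControllable (interconnectedGraph n k s) (zeroPad n fun i : Fin k => b i) ↔
      b ((k + 1) / 2 - 1) + b ((k + 1) / 2) = 1 := by
  constructor
  · contrapose
    intro h
    obtain ⟨μ, Y, hop, h0, h1, h2⟩ := exists_twin_eigenvector (by omega : 2 ≤ k)
    -- The linked vertex of the first copy is not a twin. For the terminal end this needs `4 ≤ k`:
    -- when `k = 3` the terminal vertex is itself a twin.
    have hpos : Y ((s 0).pos k) = 0 := by
      cases hs0 : s 0 with
      | dominating =>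
        exact h2 _ (by simp only [LinkEnd.pos]; omega) (by simp only [LinkEnd.pos]; omega)
      | terminal =>
        have := (hs hs0).1
        exact h2 _ (by simp only [LinkEnd.pos]; omega) (by simp only [LinkEnd.pos]; omega)
    -- The twin eigenvector extended by zero: it vanishes at both ends of every link, so no flow
    -- leaves the first copy.
    let X : ℕ → ℕ → ℝ := fun a i => if a = 0 then Y i else 0
    have hflow : ∀ a, linkFlow n k s X a = 0 := by
      intro a
      cases a with
      | zero => rfl
      | succ a =>
        cases a with
        | zero => simp [linkFlow, X, hpos]
        | succ a => simp [linkFlow, X]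
    refine not_laplacianControllable_of_eigenvector _
      (v := fun v : Fin n × Fin k => X v.1 v.2) (μ := μ) ?_ ?_ ?_
    · ext v
      rw [interconnectedGraph_lapMatrix_mulVec (by omega), hflow, hflow, ite_self, ite_self,
        sub_self, sub_zero, Pi.smul_apply, smul_eq_mul]
      by_cases hv : (v.1 : ℕ) = 0
      · have := hop v.2 v.2.2
        rw [antiregularOp_eq_sub] at this
        simp only [X, hv, if_true]
        linarith
      · simp [X, hv, antiregularOp]
    · rw [dotProduct_zeroPad hn]
      exact sum_mul_eq_zero_of_twin (by omega)
        (eq_of_add_ne_one (hb _ (by omega)) (hb _ (by omega)) h) h1 h2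
    · exact fun h => h0 (congrFun h (⟨0, hn⟩, ⟨(k + 1) / 2 - 1, by omega⟩))
  · intro h
    refine laplacianControllable_of_eigenvector _ fun μ v hv hvb => ?_
    obtain ⟨X, rfl⟩ : ∃ X : ℕ → ℕ → ℝ, v = fun w : Fin n × Fin k => X w.1 w.2 :=
      ⟨fun a i => if h : a < n ∧ i < k then v (⟨a, h.1⟩, ⟨i, h.2⟩) else 0, by ext w; simp⟩
    rw [dotProduct_zeroPad hn] at hvb
    have h1 := chain_eq_zero hn hk hb h hs (μ := μ) (X := X) (F := linkFlow n k s X) rfl ?_ ?_ ?_ hvb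
    · ext w
      exact h1 w.1 w.1.2 w.2 w.2.2
    · obtain ⟨m, rfl⟩ : ∃ m, n = m + 1 := ⟨n - 1, by omega⟩
      simp [linkFlow]
    · intro a ha
      simp [linkFlow, ha]
    · intro a ha i hi
      have := congrFun hv (⟨a, ha⟩, ⟨i, hi⟩)
      rw [interconnectedGraph_lapMatrix_mulVec (by omega), Pi.smul_apply, smul_eq_mul] at this
      simp only at this
      rw [antiregularOp_eq_sub]
      linarith

end Laplacian

theorem mainTheorem4 (k₁ k₂ : ℕ) (hk₁ : 1 ≤ k₁) (hk₂ : 3 ≤ k₂) (s : ℕ → LinkEnd)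
    (b : Fin k₂ → ℝ) (hb : ∀ j, b j = 0 ∨ b j = 1) :
    (s 0 = LinkEnd.dominating →
      List.TFAE [
        b ⟨(k₂ + 1) / 2 - 1, by omega⟩ + b ⟨(k₂ + 1) / 2, by omega⟩ = 1,
        LaplacianControllable (antiregularGraph k₂) b,
        LaplacianControllable (interconnectedGraph k₁ k₂ s) (zeroPad k₁ b)]) ∧
    (s 0 = LinkEnd.terminal → 4 ≤ k₂ → b ⟨k₂ - 1, by omega⟩ = 0 →
      List.TFAE [
        b ⟨(k₂ + 1) / 2 - 1, by omega⟩ + b ⟨(k₂ + 1) / 2, by omega⟩ = 1,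
        LaplacianControllable (antiregularGraph k₂) b,
        LaplacianControllable (interconnectedGraph k₁ k₂ s) (zeroPad k₁ b)]) := by
  obtain ⟨B, rfl⟩ : ∃ B : ℕ → ℝ, b = fun i : Fin k₂ => B i :=
    ⟨fun i => if h : i < k₂ then b ⟨i, h⟩ else 0, by ext i; simp⟩
  have hB : ∀ i < k₂, B i = 0 ∨ B i = 1 := fun i hi => hb ⟨i, hi⟩
  have h12 := antiregularGraph_laplacianControllable_iff (by omega : 2 ≤ k₂) hB
  have main : (s 0 = .terminal → 4 ≤ k₂ ∧ B (k₂ - 1) = 0) → List.TFAE [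
      B ((k₂ + 1) / 2 - 1) + B ((k₂ + 1) / 2) = 1,
      LaplacianControllable (antiregularGraph k₂) (fun i => B i),
      LaplacianControllable (interconnectedGraph k₁ k₂ s) (zeroPad k₁ fun i : Fin k₂ => B i)] := by
    intro hs
    have h13 := interconnectedGraph_laplacianControllable_iff hk₁ hk₂ hB hs
    tfae_have 1 ↔ 2 := h12.symm
    tfae_have 1 ↔ 3 := h13.symm
    tfae_finish
  exact ⟨fun h => main fun h' => LinkEnd.noConfusion (h.symm.trans h'), fun _ h4 hbt => main fun _ => ⟨h4, hbt⟩⟩
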